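/- Let $K$ be a field and let $R$ be a commutative $K$-algebra that is an integral domain, with a distinguished maximal ideal $\mathfrak m$ and residue field $\Bbbk = R/\mathfrak m$. Notation. $D^n_{R|K}\subseteq \operatorname{Hom}_K(R,R)$ denotes the $K$-linear differential operators of order at most $n$: $D^0_{R|K}=\operatorname{Hom}_R(R,R)$, and for $n\ge 1$, $\delta\in D^{n}_{R|K}$ iff $[\delta,r]\in D^{n-1}_{R|K}$ for all $r\in R$. For $n\geq 1$ the $n$-th differential power of $\mathfrak m$ is $\mathfrak m^{\langle n\rangle_K}=\{f\in R : \delta(f)\in\mathfrak m \text{ for all } \delta\in D^{n-1}_{R|K}\}$. The module of principal parts is $P^n_{R|K}=(R\otimes_K R)/\Delta^{n+1}$, where $\Delta$ is the kernel of the multiplication map $R\otimes_K R\to R$; it is an $R$-module via the left factor. The free rank of an $R$-module $M$ is the supremum of the $a$ with $M\cong R^a\oplus M'$ for some $M'$; the rank of $M$ is $\dim_{\operatorname{Frac}(R)}(\operatorname{Frac}(R)\otimes_R M)$; $\lambda_R$ is length. With $d=\dim R$, the differential signature of $R$ is $$ s_K(R)=\limsup_{n\to\infty}\frac{\lambda_R(R/\mathfrak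 m^{\langle n\rangle_K})}{n^d/d!}. $$ (1) Suppose that $(R,\mathfrak m,\Bbbk)$ is an algebra with pseudocoefficient field $K$; that is, either $R$ is $\mathbb N$-graded and finitely generated over $R_0=K$ and $\mathfrak m$ is its homogeneous maximal ideal, or $R$ is local and essentially of finite type over $K$ with maximal ideal $\mathfrak m$; and $K\to\Bbbk$ is a finite separable field extension. Suppose moreover that the (not necessarily algebraic) field extension $\operatorname{Frac}(R)/K$ is separable. Then $$ s_K(R)=\limsup_{n\to\infty}\frac{\operatorname{freerank}_R(P^n_{R|K})}{\operatorname{rank}_R(P^n_{R|K})}. $$ (2) Suppose that $(R,\mathfrak m,\Bbbk)$ is a complete Noetherian local domain with coefficient field $K$; that is, the map $K\to\Bbbk$ is an isomorphism. Then $$ s_K(R)=\limsup_{n\to\infty}\frac{\operatorname{freerank}_R(P^n_{R|K})}{\binom{n+d}{n}}. $$ -/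

import Mathlib

open scoped TensorProduct ENNReal
open Filter

namespace DiffSig

section DifferentialOperators

variable (A R : Type*) [CommRing A] [CommRing R] [Algebra A R]

/-- The commutator `[δ, r] = δ ∘ (r ·) - (r ·) ∘ δ` of an `A`-linear endomorphism `δ` of `R` with
the multiplication by `r`. -/
def commutator (δ : R →ₗ[A] R) (r : R) : R →ₗ[A] R :=
  δ ∘ₗ LinearMap.mulLeft A r - LinearMap.mulLeft A r ∘ₗ δ

@[simp] theorem commutator_apply (δ : R →ₗ[A] R) (r x : R) :
    commutator A R δ r x = δ (r * x) - r * δ x := rfl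

/-- `D^n_{R|A}`: the `A`-linear differential operators on `R` of order at most `n`, as an
`R`-submodule of `Hom_A(R, R)` (with `R` acting by postcomposition). Operators of order `0` are the
`R`-linear maps, and `δ` has order at most `n + 1` if all the commutators `[δ, r]` have order at
most `n`. -/
def diffOp : ℕ → Submodule R (R →ₗ[A] R)
  | 0 =>
    { carrier := {δ | ∀ r x : R, δ (r * x) = r * δ x}
      add_mem' := by
        intro δ ε hδ hε r x
        simp only [Set.mem_ofPred_eq] at hδ hε
        simp only [LinearMap.add_apply, hδ, hε]
        ring
      zero_mem' := by
        intro r x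
        simp
      smul_mem' := by
        intro c δ hδ r x
        simp only [Set.mem_ofPred_eq] at hδ
        simp only [LinearMap.smul_apply, hδ, smul_eq_mul]
        ring }
  | n + 1 =>
    { carrier := {δ | ∀ r : R, commutator A R δ r ∈ diffOp n}
      add_mem' := by
        intro δ ε hδ hε r
        have h : commutator A R (δ + ε) r = commutator A R δ r + commutator A R ε r := by
          ext x
          simp only [commutator_apply, LinearMap.add_apply]
          ring
        rw [h]
        exact (diffOp n).add_mem (hδ r) (hε r)
      zero_mem' := by
        intro r
        have h : commutator A R 0 r = 0 := by
          ext x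
          simp
        rw [h]
        exact (diffOp n).zero_mem
      smul_mem' := by
        intro c δ hδ r
        have h : commutator A R (c • δ) r = c • commutator A R δ r := by
          ext x
          simp only [commutator_apply, LinearMap.smul_apply, smul_eq_mul]
          ring
        rw [h]
        exact (diffOp n).smul_mem c (hδ r) }

theorem mem_diffOp_zero {δ : R →ₗ[A] R} :
    δ ∈ diffOp A R 0 ↔ ∀ r x : R, δ (r * x) = r * δ x := Iff.rfl

theorem mem_diffOp_succ {n : ℕ} {δ : R →ₗ[A] R} :
    δ ∈ diffOp A R (n + 1) ↔ ∀ r : R, commutator A R δ r ∈ diffOp A R n := Iff.rfl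

/-- Precomposition with a multiplication does not raise the order. -/
theorem comp_mulLeft_mem_diffOp (n : ℕ) {δ : R →ₗ[A] R} (hδ : δ ∈ diffOp A R n) (r : R) :
    δ ∘ₗ LinearMap.mulLeft A r ∈ diffOp A R n := by
  induction n generalizing δ with
  | zero =>
    rw [mem_diffOp_zero] at hδ ⊢
    intro s x
    simp only [LinearMap.comp_apply, LinearMap.mulLeft_apply, hδ]
    ring
  | succ n ih =>
    rw [mem_diffOp_succ] at hδ ⊢
    intro s
    have h : commutator A R (δ ∘ₗ LinearMap.mulLeft A r) s
        = commutator A R δ s ∘ₗ LinearMap.mulLeft A r := by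
      ext x
      simp only [commutator_apply, LinearMap.comp_apply, LinearMap.mulLeft_apply]
      rw [mul_left_comm]
    rw [h]
    exact ih (hδ s)

variable {R}

/-- The `n`-th `A`-linear differential power `I^{<n>_A}` of an ideal `I`, for `n ≥ 1`: the elements
that are sent into `I` by all differential operators of order at most `n - 1`. (For `n = 0`, where
the notion is not used, truncated subtraction makes it equal to the first one.) -/
def diffPower (I : Ideal R) (n : ℕ) : Ideal R where
  carrier := {f | ∀ δ ∈ diffOp A R (n - 1), δ f ∈ I}
  add_mem' := by
    intro f g hf hg δ hδ
    rw [map_add]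
    exact I.add_mem (hf δ hδ) (hg δ hδ)
  zero_mem' := by
    intro δ _
    rw [map_zero]
    exact I.zero_mem
  smul_mem' := by
    intro c f hf δ hδ
    exact hf _ (comp_mulLeft_mem_diffOp A R (n - 1) hδ c)

end DifferentialOperators

section PrincipalParts

variable (A R : Type*) [CommRing A] [CommRing R] [Algebra A R]

/-- The module of principal parts `P^n_{R|A} = (R ⊗_A R) / Δ^{n+1}`, where `Δ` is the kernel of the
multiplication map `R ⊗_A R → R`. As an `R`-module it carries the structure coming from the left
tensor factor. -/
abbrev PrincipalParts (n : ℕ) : Type _ :=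
  (R ⊗[A] R) ⧸ (KaehlerDifferential.ideal A R) ^ (n + 1)

/-- The free rank of `M`: the supremum of all `a` for which `M` is the direct sum of a free
submodule of rank `a` and another submodule. -/
noncomputable def freeRank (M : Type*) [AddCommGroup M] [Module R M] : ℕ∞ :=
  ⨆ (a : ℕ) (_ : ∃ F N : Submodule R M, IsCompl F N ∧ Nonempty (F ≃ₗ[R] (Fin a → R))), (a : ℕ∞)

/-- The (generic) rank of a module `M` over a domain `R`: the dimension of `Frac(R) ⊗_R M` over
`Frac(R)`. -/
noncomputable def genericRank [IsDomain R] (M : Type*) [AddCommGroup M] [Module R M] : ℕ∞ :=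
  Cardinal.toENat (Module.rank (FractionRing R) (FractionRing R ⊗[R] M))

end PrincipalParts

/-- The Krull dimension of a ring of finite Krull dimension, as a natural number. -/
noncomputable def dim (R : Type*) [CommRing R] : ℕ := ((ringKrullDim R).unbotD 0).toNat

section Signatures

variable (A : Type*) {R : Type*} [CommRing A] [CommRing R] [Algebra A R]

/-- The differential signature `limsup_n λ_R(R / m^{<n>_A}) / (n^d / d!)`, `d = dim R`, as an
element of `[0, ∞]`. -/
noncomputable def differentialSignature (m : Ideal R) : ℝ≥0∞ :=
  limsup (fun n : ℕ =>
    ((Module.length R (R ⧸ diffPower A m n) : ℕ∞) : ℝ≥0∞) /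
      ((n : ℝ≥0∞) ^ dim R / ((dim R).factorial : ℝ≥0∞))) atTop

variable (R)

/-- The principal parts signature `limsup_n freerank(P^n_{R|A}) / rank(P^n_{R|A})` of a domain `R`
over `A`, as an element of `[0, ∞]`. -/
noncomputable def principalPartsSignature [IsDomain R] : ℝ≥0∞ :=
  limsup (fun n : ℕ =>
    ((freeRank R (PrincipalParts A R n) : ℕ∞) : ℝ≥0∞) /
      ((genericRank R (PrincipalParts A R n) : ℕ∞) : ℝ≥0∞)) atTop

/-- The principal parts signature of a complete local domain `R` of dimension `d` over a coefficient
field: `limsup_n freerank(P^n_{R|A}) / binom(n + d, n)`, as an element of `[0, ∞]`. -/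
noncomputable def completePrincipalPartsSignature : ℝ≥0∞ :=
  limsup (fun n : ℕ =>
    ((freeRank R (PrincipalParts A R n) : ℕ∞) : ℝ≥0∞) /
      ((n + dim R).choose n : ℝ≥0∞)) atTop

end Signatures

section Hypotheses

variable (K : Type*) {R : Type*} [Field K] [CommRing R] [Algebra K R]

/-- `R` is a finitely generated `ℕ`-graded algebra over its degree zero part `K`, with homogeneous
maximal ideal `m` (the ideal of the elements whose degree zero component vanishes). -/
def IsGradedCase (m : Ideal R) : Prop :=
  Algebra.FiniteType K R ∧
    ∃ (𝒜 : ℕ → Submodule K R) (_ : GradedAlgebra 𝒜),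
      𝒜 0 = LinearMap.range (Algebra.linearMap K R) ∧
      m = (HomogeneousIdeal.irrelevant 𝒜).toIdeal

/-- `R` is local, essentially of finite type over `K`, with maximal ideal `m`. -/
def IsLocalCase (m : Ideal R) : Prop :=
  Algebra.EssFiniteType K R ∧ ∃ _ : IsLocalRing R, m = IsLocalRing.maximalIdeal R

/-- `(R, m)` is an algebra with pseudocoefficient field `K`. -/
structure IsAlgebraWithPseudocoefficientField (m : Ideal R) : Prop where
  nontrivial : Nontrivial R
  graded_or_local : IsGradedCase K m ∨ IsLocalCase K m
  isMaximal : m.IsMaximal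
  finite_residueField : Module.Finite K (R ⧸ m)
  isSeparable_residueField : Algebra.IsSeparable K (R ⧸ m)

/-- `(R, m)` is a complete (Noetherian) local ring with coefficient field `K`: the map from `K` to
the residue field `R / m` is bijective. -/
structure IsCompleteLocalWithCoefficientField (m : Ideal R) : Prop where
  isLocalRing : IsLocalRing R
  isNoetherianRing : IsNoetherianRing R
  eq_maximalIdeal : m = IsLocalRing.maximalIdeal R
  isAdicComplete : IsAdicComplete m R
  bijective_residueField : Function.Bijective (algebraMap K (R ⧸ m))

end Hypotheses

/-- A field extension `E / K` is separably generated if it has a transcendence basis `s` such that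
`E` is a separable algebraic extension of `K(s)`. -/
def IsSeparablyGenerated (K E : Type*) [Field K] [Field E] [Algebra K E] : Prop :=
  ∃ s : Set E, IsTranscendenceBasis K ((↑) : s → E) ∧
    Algebra.IsSeparable (IntermediateField.adjoin K s) E

/-- A (not necessarily algebraic) field extension `F / K` is separable if each of its finitely
generated subextensions is separably generated. -/
def IsSeparableExtension (K F : Type*) [Field K] [Field F] [Algebra K F] : Prop :=
  ∀ E : IntermediateField K F, E.FG → IsSeparablyGenerated K E

end DiffSig

/-!
The heart of the matter is the identity `freerank(P^n) = length(R / m^{<n+1>})`, valid for all `n`.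

A differential operator of order at most `n` is the same as an `R`-linear functional on `P^n`,
composed with the universal operator `d : R → P^n`, `f ↦ 1 ⊗ f` (`mem_diffOp_iff`). Hence
`m^{<n+1>}` is the preimage under `d` of the submodule `N ⊆ P^n` of elements that all functionals
send into `m` (`mem_diffPower_succ_iff`). Since `R / m` is separable over `K`, hence formally
étale, `d` maps `R` onto `P^n / m P^n` (`exists_univDiff_sub_mem`), so `R / m^{<n+1>}` and
`P^n / N` are isomorphic over `K`. Their `K`-dimensions are their lengths times the finite degree
of `R / m` over `K`, so the lengths agree (`length_quotient_diffPower`).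

A free summand of `P^n` of rank `a` shows that `P^n / N` has length at least `a`. Conversely,
elements of `P^n` independent modulo `N` pair with suitable functionals to a matrix that is the
identity modulo `m` (`exists_dual_basis_mod`). If `R` is local, this matrix is invertible, and the
elements span a free summand. If `R` is graded, the elements can be taken of the form `d f` with
`f` homogeneous, and the functionals can be replaced by homogeneous components of the corresponding
operators; the determinant then has degree zero, so it lies in `K` and is again invertible
(`length_le_freeRank_of_graded`).

As `(n + 1) ^ d / d!` and `binom(n + d, n)` are asymptotically equivalent, this settles the
complete case. For algebras with a pseudocoefficient field it remains to see that `P^n` has rank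
`binom(n + d, n)`. A separating transcendence basis of `Frac(R)` is a system of étale coordinates
(`formallyEtale_aeval_of_isSeparable`), and Taylor expansion in these coordinates identifies
`Frac(R) ⊗ P^n` with a polynomial ring truncated at degree `n`
(`genericRank_principalParts_of_formallyEtale`). The number of coordinates is the transcendence
degree of `R`, which is `dim R` by Noether normalization and going down
(`height_eq_trdeg_of_isMaximal`).
-/

namespace DiffSig

/-! ### Krull dimension and transcendence degree -/

section Dimension

theorem height_mvPolynomial_of_isMaximal (K : Type*) [Field K] (s : ℕ)
    (P : Ideal (MvPolynomial (Fin s) K)) [P.IsMaximal] : P.height = s := by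
  induction s with
  | zero =>
    have hP : P = ⊥ := by
      let e := MvPolynomial.isEmptyRingEquiv K (Fin 0)
      have : IsField (MvPolynomial (Fin 0) K) := e.toMulEquiv.isField (Field.toIsField K)
      let := this.toField
      exact (Ideal.eq_bot_or_top P).resolve_right (Ideal.IsMaximal.ne_top ‹_›)
    rw [hP]
    simp
  | succ s ih =>
    let e := (MvPolynomial.finSuccEquiv K s).toRingEquiv
    let P' : Ideal (Polynomial (MvPolynomial (Fin s) K)) := P.map e
    have hP' : P'.IsMaximal := Ideal.map_isMaximal_of_equiv e
    have : (P'.under (MvPolynomial (Fin s) K)).IsMaximal :=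
      Polynomial.isMaximal_comap_C_of_isJacobsonRing P'
    have : P'.LiesOver (P'.under (MvPolynomial (Fin s) K)) := ⟨rfl⟩
    have h := Polynomial.height_eq_height_add_one (P'.under (MvPolynomial (Fin s) K)) P'
    rw [ih] at h
    rw [← e.height_map P, h]
    simp

/-- Going down, available because the base is integrally closed, makes heights of maximal ideals
invariant under integral extensions of domains: the fibre over the contracted maximal ideal
contributes nothing, since all its primes are maximal. -/
theorem height_eq_of_isIntegral {B A : Type*} [CommRing B] [CommRing A] [Algebra B A] [IsDomain A]
    [IsNoetherianRing A] [IsNoetherianRing B] [IsDomain B] [IsIntegrallyClosed B]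
    [Algebra.IsIntegral B A] [FaithfulSMul B A] (P : Ideal A) [P.IsMaximal] :
    P.height = (P.under B).height := by
  have hp : (P.under B).IsMaximal := Ideal.isMaximal_comap_of_isIntegral_of_isMaximal P
  have h := Ideal.height_eq_height_add_of_liesOver_of_hasGoingDown (P.under B) P
  rw [h]
  convert add_zero _
  -- it remains to see that the image of `P` in the fibre ring `A / I` is a minimal prime
  set I := (P.under B).map (algebraMap B A) with hI
  have hIP : I ≤ P := Ideal.map_comap_le
  have : (P.map (Ideal.Quotient.mk I)).IsPrime :=
    Ideal.map_isPrime_of_surjective Ideal.Quotient.mk_surjective (by simpa using hIP)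
  rw [Ideal.height_eq_zero_iff]
  refine ⟨⟨this, bot_le⟩, ?_⟩
  rintro Q ⟨hQ, -⟩ hQP
  have hQm : (Q.comap (Ideal.Quotient.mk I)).IsMaximal := by
    have : (Q.comap (Ideal.Quotient.mk I)).IsPrime := Ideal.comap_isPrime _ _
    refine Ideal.isMaximal_of_isIntegral_of_isMaximal_comap (R := B) _ ?_
    have heq : P.under B = (Q.comap (Ideal.Quotient.mk I)).comap (algebraMap B A) := by
      refine hp.eq_of_le (Ideal.IsPrime.ne_top inferInstance) ?_
      intro x hx
      have : algebraMap B A x ∈ I := Ideal.mem_map_of_mem _ hx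
      simp [Ideal.mem_comap, Ideal.Quotient.eq_zero_iff_mem.mpr this]
    rwa [← heq]
  have h1 : Q.comap (Ideal.Quotient.mk I) = P := by
    refine hQm.eq_of_le (Ideal.IsMaximal.ne_top ‹_›) ?_
    refine (Ideal.comap_mono hQP).trans ?_
    rw [Ideal.comap_map_of_surjective _ Ideal.Quotient.mk_surjective, ← RingHom.ker_eq_comap_bot,
      Ideal.mk_ker]
    simpa using hIP
  rw [← h1, Ideal.map_comap_of_surjective _ Ideal.Quotient.mk_surjective]

/-- All maximal ideals of an affine domain have the same height, the transcendence degree: by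
Noether normalization the claim reduces to a polynomial ring. -/
theorem height_eq_trdeg_of_isMaximal (K A : Type*) [Field K] [CommRing A] [IsDomain A]
    [Algebra K A] [Algebra.FiniteType K A] (P : Ideal A) [P.IsMaximal] :
    P.height = Cardinal.toENat (Algebra.trdeg K A) := by
  obtain ⟨s, g, hg, hgi⟩ := exists_integral_inj_algHom_of_fg K A
  let := g.toRingHom.toAlgebra
  have : IsScalarTower K (MvPolynomial (Fin s) K) A :=
    IsScalarTower.of_algebraMap_eq fun x => (g.commutes x).symm
  have : Algebra.IsIntegral (MvPolynomial (Fin s) K) A := ⟨hgi⟩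
  have : FaithfulSMul (MvPolynomial (Fin s) K) A :=
    (faithfulSMul_iff_algebraMap_injective _ _).mpr hg
  have : IsNoetherianRing A := Algebra.FiniteType.isNoetherianRing K A
  have hp : (P.under (MvPolynomial (Fin s) K)).IsMaximal :=
    Ideal.isMaximal_comap_of_isIntegral_of_isMaximal P
  rw [height_eq_of_isIntegral (B := MvPolynomial (Fin s) K) P, height_mvPolynomial_of_isMaximal]
  have h := lift_trdeg_add_eq K (MvPolynomial (Fin s) K) A
  have h0 : Algebra.trdeg (MvPolynomial (Fin s) K) A = 0 := trdeg_eq_zero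
  rw [h0] at h
  have := congrArg Cardinal.toENat h
  simpa [MvPolynomial.trdeg_of_isDomain] using this

theorem dim_eq_of_ringKrullDim_eq {R : Type*} [CommRing R] {t : ℕ}
    (h : ringKrullDim R = (t : ℕ∞)) : dim R = t := by
  rw [dim, h]
  rfl

theorem dim_eq_trdeg_of_finiteType (K R : Type*) [Field K] [CommRing R] [IsDomain R]
    [Algebra K R] [Algebra.FiniteType K R] {t : ℕ} (ht : Algebra.trdeg K R = t) :
    dim R = t := by
  apply dim_eq_of_ringKrullDim_eq
  have key : ∀ P : Ideal R, P.IsMaximal → P.height = t := fun P hP => by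
    rw [height_eq_trdeg_of_isMaximal K R P, ht]
    simp
  apply le_antisymm
  · rw [ringKrullDim_le_iff_isMaximal_height_le]
    intro P hP
    rw [key P hP]
  · obtain ⟨P, hP⟩ := Ideal.exists_maximal R
    rw [← key P hP]
    exact Ideal.height_le_ringKrullDim_of_ne_top hP.ne_top

/-- The local ring is a localization of an affine domain at a prime, and finiteness of the residue
field over `K` forces this prime to be maximal. -/
theorem dim_eq_trdeg_of_essFiniteType (K R : Type*) [Field K] [CommRing R] [IsDomain R]
    [Algebra K R] [Algebra.EssFiniteType K R] [IsLocalRing R]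
    [Module.Finite K (R ⧸ IsLocalRing.maximalIdeal R)] {t : ℕ} (ht : Algebra.trdeg K R = t) :
    dim R = t := by
  apply dim_eq_of_ringKrullDim_eq
  let A := Algebra.EssFiniteType.subalgebra K R
  let M := Algebra.EssFiniteType.submonoid K R
  let p := (IsLocalRing.maximalIdeal R).under A
  have hp : p.IsMaximal := by
    have hinj : Function.Injective (algebraMap (A ⧸ p) (R ⧸ IsLocalRing.maximalIdeal R)) :=
      Ideal.algebraMap_quotient_injective
    have h1 : Algebra.IsIntegral K (A ⧸ p) :=
      Algebra.IsIntegral.of_injective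
        (IsScalarTower.toAlgHom K (A ⧸ p) (R ⧸ IsLocalRing.maximalIdeal R)) hinj
    exact Ideal.Quotient.maximal_of_isField _
      (isField_of_isIntegral_of_isField' (R := K) (Field.toIsField K))
  have h1 : ringKrullDim R = p.height := by
    rw [← IsLocalRing.maximalIdeal_height_eq_ringKrullDim, IsLocalization.height_under M]
  have h2 : Algebra.trdeg A R = 0 := by
    have : Algebra.IsAlgebraic A R := IsLocalization.isAlgebraic R M
    exact trdeg_eq_zero
  have h3 := trdeg_add_eq K A (A := R)
  rw [h1, height_eq_trdeg_of_isMaximal K A p]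
  rw [h2, ht, add_zero] at h3
  rw [h3]
  simp

end Dimension

/-! ### Lifting along étale coordinates -/

section EtaleCoordinates

variable {K L Q σ : Type*} [CommRing K] [CommRing L] [Algebra K L] [CommRing Q] [Algebra K Q]
  {x : σ → L}

/-- Let `x` be étale coordinates of `L` over `K`, that is, `K[X] → L` is formally étale. Then the
images of the `x i` under a `K`-algebra map `g : L → Q` may be moved arbitrarily within a nilpotent
ideal, and `g` deforms along with them. -/
theorem exists_algHom_of_formallyEtale
    (hx : (MvPolynomial.aeval (R := K) x).toRingHom.FormallyEtale)
    {I : Ideal Q} (hI : IsNilpotent I) (g : L →ₐ[K] Q) (q : σ → Q)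
    (hq : ∀ i, q i - g (x i) ∈ I) :
    ∃ T : L →ₐ[K] Q, (∀ i, T (x i) = q i) ∧ ∀ l, T l - g l ∈ I := by
  let aL : Algebra (MvPolynomial σ K) L := (MvPolynomial.aeval (R := K) x).toRingHom.toAlgebra
  let aQ : Algebra (MvPolynomial σ K) Q := (MvPolynomial.aeval (R := K) q).toRingHom.toAlgebra
  have : Algebra.FormallyEtale (MvPolynomial σ K) L := hx
  have hg : ∀ p : MvPolynomial σ K, Ideal.Quotient.mk I (g (MvPolynomial.aeval x p)) =
      Ideal.Quotient.mk I (MvPolynomial.aeval q p) := by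
    intro p
    have : (((Ideal.Quotient.mkₐ K I).comp g).comp (MvPolynomial.aeval x)) =
        (Ideal.Quotient.mkₐ K I).comp (MvPolynomial.aeval q) := by
      ext i
      simpa using (Ideal.Quotient.eq.mpr (hq i)).symm
    exact DFunLike.congr_fun this p
  let g' : L →ₐ[MvPolynomial σ K] Q ⧸ I :=
    { (Ideal.Quotient.mk I).comp g.toRingHom with
      commutes' := hg }
  let T := Algebra.FormallySmooth.lift I hI g'
  have hT : ∀ l, Ideal.Quotient.mk I (T l) = Ideal.Quotient.mk I (g l) := fun l =>
    Algebra.FormallySmooth.mk_lift I hI g' l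
  have hc : ∀ p : MvPolynomial σ K, T (MvPolynomial.aeval x p) = MvPolynomial.aeval q p :=
    fun p => T.commutes p
  refine ⟨{ T.toRingHom with commutes' := fun r => ?_ }, fun i => ?_, fun l => ?_⟩
  · simp
  · simpa using hc (MvPolynomial.X i)
  · exact Ideal.Quotient.eq.mp (hT l)

/-- Two `K`-algebra maps that agree modulo a nilpotent ideal are equal once they agree on étale
coordinates. -/
theorem algHom_ext_of_formallyEtale
    (hx : (MvPolynomial.aeval (R := K) x).toRingHom.FormallyEtale)
    {I : Ideal Q} (hI : IsNilpotent I) {T T' : L →ₐ[K] Q} (hTx : ∀ i, T (x i) = T' (x i))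
    (hT : ∀ l, T l - T' l ∈ I) : T = T' := by
  let aL : Algebra (MvPolynomial σ K) L := (MvPolynomial.aeval (R := K) x).toRingHom.toAlgebra
  let aQ : Algebra (MvPolynomial σ K) Q :=
    (MvPolynomial.aeval (R := K) fun i => T (x i)).toRingHom.toAlgebra
  have : Algebra.FormallyEtale (MvPolynomial σ K) L := hx
  have hc (U : L →ₐ[K] Q) (hU : ∀ i, U (x i) = T (x i)) (p : MvPolynomial σ K) :
      U (MvPolynomial.aeval x p) = MvPolynomial.aeval (fun i => T (x i)) p := by
    have : U.comp (MvPolynomial.aeval x) = MvPolynomial.aeval fun i => T (x i) := by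
      ext i
      simp [hU i]
    exact DFunLike.congr_fun this p
  let S : L →ₐ[MvPolynomial σ K] Q := { T.toRingHom with commutes' := hc T fun _ => rfl }
  let S' : L →ₐ[MvPolynomial σ K] Q :=
    { T'.toRingHom with commutes' := hc T' fun i => (hTx i).symm }
  have : S = S' := Algebra.FormallyUnramified.ext I hI fun l => Ideal.Quotient.eq.mpr (hT l)
  ext l
  exact DFunLike.congr_fun this l

end EtaleCoordinates

/-! ### The generic rank of the modules of principal parts -/

section GenericRank

theorem card_degree_le (σ : Type*) [Fintype σ] (n : ℕ) :
    Nat.card {d : σ →₀ ℕ // d.degree ≤ n} = (n + Fintype.card σ).choose n := by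
  classical
  -- a slack variable turns the condition `degree ≤ n` into `degree = n`
  let e : {d : σ →₀ ℕ // d.degree ≤ n} ≃
      {d : Option σ →₀ ℕ // d ∈ Finset.univ.finsuppAntidiag n} :=
    { toFun := fun d => ⟨d.1.optionElim (n - d.1.degree), by
        have := d.2
        rw [Finsupp.degree_eq_sum] at this
        simp [Fintype.sum_option, Finsupp.degree_eq_sum, this]⟩
      invFun := fun d => ⟨d.1.some, by
        have := d.2
        simp only [Finset.mem_finsuppAntidiag, Fintype.sum_option] at this
        rw [Finsupp.degree_eq_sum]
        simp only [Finsupp.some_apply]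
        lia⟩
      left_inv := fun d => by simp
      right_inv := fun d => by
        have := d.2
        simp only [Finset.mem_finsuppAntidiag, Fintype.sum_option] at this
        have h : n - d.1.some.degree = d.1 none := by
          rw [Finsupp.degree_eq_sum]
          simp only [Finsupp.some_apply]
          lia
        ext1
        simp [h] }
  rw [Nat.card_congr e, Nat.card_eq_fintype_card, Fintype.card_coe,
    Finset.card_finsuppAntidiag_nat_eq_choose, Finset.card_univ, Fintype.card_option]
  congr 1
  lia

/-- The truncated polynomial ring has the monomials of degree at most `n` as a basis. -/
theorem rank_quotient_pow_idealOfVars (L σ : Type*) [Field L] [Fintype σ] (n : ℕ) :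
    Module.rank L (MvPolynomial σ L ⧸ MvPolynomial.idealOfVars σ L ^ (n + 1)) =
      ((n + Fintype.card σ).choose n : ℕ) := by
  let ι := {d : σ →₀ ℕ // d.degree ≤ n}
  let c : MvPolynomial σ L →ₗ[L] (ι → L) := LinearMap.pi fun d => MvPolynomial.lcoeff L d.1
  have hfin : Finite ι := Nat.finite_of_card_ne_zero (by
    rw [card_degree_le]; exact (Nat.choose_pos (Nat.le_add_right _ _)).ne')
  have hker : LinearMap.ker c = (MvPolynomial.idealOfVars σ L ^ (n + 1)).restrictScalars L := by
    ext p
    rw [Submodule.restrictScalars_mem, MvPolynomial.mem_pow_idealOfVars_iff', LinearMap.mem_ker]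
    constructor
    · intro h d hd
      exact congrFun h ⟨d, Nat.lt_succ_iff.mp hd⟩
    · intro h
      ext d
      exact h d.1 (Nat.lt_succ_iff.mpr d.2)
  have hsurj : Function.Surjective c := by
    intro v
    have := Fintype.ofFinite ι
    refine ⟨∑ d : ι, MvPolynomial.monomial d.1 (v d), ?_⟩
    ext e
    classical
    simp only [c, LinearMap.pi_apply, MvPolynomial.lcoeff_apply, MvPolynomial.coeff_sum,
      MvPolynomial.coeff_monomial, Subtype.ext_iff.symm]
    exact (Finset.sum_ite_eq' _ e v).trans (if_pos (Finset.mem_univ e))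
  have e1 : (MvPolynomial σ L ⧸ MvPolynomial.idealOfVars σ L ^ (n + 1)) ≃ₗ[L] (ι → L) :=
    (Submodule.Quotient.restrictScalarsEquiv L _).symm.trans
      ((Submodule.quotEquivOfEq _ _ hker.symm).trans (c.quotKerEquivOfSurjective hsurj))
  rw [e1.rank_eq]
  have := Fintype.ofFinite ι
  rw [rank_fun', ← card_degree_le σ n, Nat.card_eq_fintype_card]

variable (K R : Type*) [Field K] [CommRing R] [Algebra K R] (n : ℕ)

/-- The universal differential operator `R → P^n_{R|K}`, `f ↦ 1 ⊗ f`. -/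
noncomputable def univDiff : R →ₐ[K] PrincipalParts K R n :=
  (Ideal.Quotient.mkₐ K _).comp Algebra.TensorProduct.includeRight

/-- The image of the diagonal ideal `Δ` in `P^n_{R|K}`. -/
noncomputable def diagIdeal : Ideal (PrincipalParts K R n) :=
  (KaehlerDifferential.ideal K R).map (Ideal.Quotient.mk _)

theorem diagIdeal_pow : diagIdeal K R n ^ (n + 1) = ⊥ := by
  rw [diagIdeal, ← Ideal.map_pow, Ideal.map_quotient_self]

theorem univDiff_sub_algebraMap_mem (r : R) :
    univDiff K R n r - algebraMap R (PrincipalParts K R n) r ∈ diagIdeal K R n :=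
  Ideal.mem_map_of_mem _ (KaehlerDifferential.one_smul_sub_smul_one_mem_ideal K r)

variable {K R n} in
/-- The universal property of principal parts: a `K`-algebra map `T : R → Q` that agrees with the
structure map of the `R`-algebra `Q` modulo an ideal with vanishing `(n + 1)`-st power factors
through `P^n`. -/
theorem exists_algHom_principalParts {Q : Type*} [CommRing Q] [Algebra K Q] [Algebra R Q]
    [IsScalarTower K R Q] {I : Ideal Q} (hI : I ^ (n + 1) = ⊥) (T : R →ₐ[K] Q)
    (hT : ∀ r, T r - algebraMap R Q r ∈ I) :
    ∃ φ : PrincipalParts K R n →ₐ[R] Q, ∀ r, φ (univDiff K R n r) = T r := by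
  let ψ : R ⊗[K] R →ₐ[R] Q := Algebra.TensorProduct.lift (Algebra.ofId R Q) T
    fun _ _ => Commute.all _ _
  have hψ : (KaehlerDifferential.ideal K R).map ψ ≤ I := by
    rw [← KaehlerDifferential.span_range_eq_ideal, Ideal.map_span, Ideal.span_le]
    rintro _ ⟨_, ⟨r, rfl⟩, rfl⟩
    simpa [ψ, Algebra.ofId_apply] using hT r
  have hψ' : ∀ a ∈ KaehlerDifferential.ideal K R ^ (n + 1), ψ a = 0 := fun a ha => by
    have := Ideal.mem_map_of_mem ψ ha
    rw [Ideal.map_pow] at this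
    simpa [hI] using Ideal.pow_right_mono hψ (n + 1) this
  refine ⟨Ideal.Quotient.liftₐ _ ψ hψ', fun r => ?_⟩
  change ψ (1 ⊗ₜ r) = T r
  simp [ψ]

section Coordinates

variable {K R L W : Type*} [Field K] [CommRing R] [Algebra K R] [Field L]
  [Algebra K L] [Algebra R L] [IsScalarTower K R L] [IsFractionRing R L] [CommRing W]
  [Algebra L W] [Algebra K W] {J : Ideal W}

/-- A `K`-algebra map on `R` that agrees with the structure map modulo a nilpotent ideal extends
to the fraction field. -/
theorem exists_extension_fractionRing (hJ : IsNilpotent J) (ρ₀ : R →ₐ[K] W)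
    (hmem : ∀ r : R, ρ₀ r - algebraMap L W (algebraMap R L r) ∈ J) :
    ∃ ρ : L →ₐ[K] W, (∀ r : R, ρ (algebraMap R L r) = ρ₀ r) ∧
      ∀ l : L, ρ l - algebraMap L W l ∈ J := by
  have hunit : ∀ r : nonZeroDivisors R, IsUnit (ρ₀ r) := fun r => by
    have h1 : IsUnit (algebraMap L W (algebraMap R L r)) :=
      (IsLocalization.map_units L r).map _
    have h2 : IsNilpotent (ρ₀ r - algebraMap L W (algebraMap R L r)) := by
      obtain ⟨n, hn⟩ := hJ
      exact ⟨n, by simpa [hn] using Ideal.pow_mem_pow (hmem r) n⟩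
    have := h2.isUnit_add_left_of_commute h1 (Commute.all _ _)
    simpa using this
  let ρ : L →ₐ[K] W := IsLocalization.liftAlgHom (M := nonZeroDivisors R) (f := ρ₀) hunit
  have hρ : ∀ r : R, ρ (algebraMap R L r) = ρ₀ r := fun r => IsLocalization.lift_eq _ r
  refine ⟨ρ, hρ, fun l => ?_⟩
  have : (Ideal.Quotient.mk J).comp ρ.toRingHom =
      (Ideal.Quotient.mk J).comp (algebraMap L W) := by
    apply IsLocalization.ringHom_ext (nonZeroDivisors R)
    ext r
    exact Ideal.Quotient.eq.mpr (by simpa [hρ] using hmem r)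
  exact Ideal.Quotient.eq.mp (RingHom.congr_fun this l)

/-- Let `W` be an `L`-algebra, where `L = Frac(R)`, with a map `ρ₀ : R → W` having the universal
property of the localized principal parts `L ⊗ P^n`; it enters through `hlift` and `hext`. If `L`
has étale coordinates `x` over `K`, then `W` is the polynomial ring over `L` truncated at degree
`n`, the variable `X i` corresponding to the Taylor increment `ρ (x i) - x i`. -/
theorem nonempty_algEquiv_of_formallyEtale [IsDomain R] [IsScalarTower K L W] {σ : Type*}
    {x : σ → L}
    (hx : (MvPolynomial.aeval (R := K) x).toRingHom.FormallyEtale) {n : ℕ}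
    (hJ : J ^ (n + 1) = ⊥) (ρ₀ : R →ₐ[K] W)
    (hmem : ∀ r : R, ρ₀ r - algebraMap L W (algebraMap R L r) ∈ J)
    (hlift : ∀ (I : Ideal (MvPolynomial σ L ⧸ MvPolynomial.idealOfVars σ L ^ (n + 1)))
      (T : R →ₐ[K] MvPolynomial σ L ⧸ MvPolynomial.idealOfVars σ L ^ (n + 1)),
      I ^ (n + 1) = ⊥ → (∀ r, T r - algebraMap L _ (algebraMap R L r) ∈ I) →
        ∃ Φ : W →ₐ[L] MvPolynomial σ L ⧸ MvPolynomial.idealOfVars σ L ^ (n + 1),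
          ∀ r, Φ (ρ₀ r) = T r)
    (hext : ∀ Ψ : W →ₐ[L] W, (∀ r, Ψ (ρ₀ r) = ρ₀ r) → Ψ = AlgHom.id L W) :
    Nonempty (W ≃ₐ[L] MvPolynomial σ L ⧸ MvPolynomial.idealOfVars σ L ^ (n + 1)) := by
  let Q := MvPolynomial σ L ⧸ MvPolynomial.idealOfVars σ L ^ (n + 1)
  let I : Ideal Q := (MvPolynomial.idealOfVars σ L).map (Ideal.Quotient.mk _)
  have hI : I ^ (n + 1) = ⊥ := by rw [← Ideal.map_pow, Ideal.map_quotient_self]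
  let y : σ → Q := fun i => Ideal.Quotient.mk _ (MvPolynomial.X i)
  have hy : ∀ i, y i ∈ I := fun i => Ideal.mem_map_of_mem _ (Ideal.subset_span ⟨i, rfl⟩)
  -- the Taylor expansion `T`, which moves `x i` to `x i + X i`
  obtain ⟨T, hTx, hT⟩ := exists_algHom_of_formallyEtale hx ⟨n + 1, hI⟩
    (IsScalarTower.toAlgHom K L Q) (fun i => algebraMap L Q (x i) + y i) (by simpa using hy)
  obtain ⟨ρ, hρ, hρJ⟩ := exists_extension_fractionRing ⟨n + 1, hJ⟩ ρ₀ hmem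
  obtain ⟨Φ, hΦ⟩ := hlift I (T.comp (IsScalarTower.toAlgHom K R L)) hI
    fun r => hT (algebraMap R L r)
  have hΦρ : ∀ l, Φ (ρ l) = T l := by
    have : Φ.toRingHom.comp ρ.toRingHom = T.toRingHom := by
      apply IsLocalization.ringHom_ext (nonZeroDivisors R)
      ext r
      simpa [hρ] using hΦ r
    exact fun l => RingHom.congr_fun this l
  -- the inverse of `Φ` sends `X i` to the Taylor increment of `x i` in `W`
  let u : MvPolynomial σ L →ₐ[L] W :=
    MvPolynomial.aeval fun i => ρ (x i) - algebraMap L W (x i)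
  have hu : (MvPolynomial.idealOfVars σ L).map u ≤ J := by
    rw [Ideal.map_span, Ideal.span_le]
    rintro _ ⟨_, ⟨i, rfl⟩, rfl⟩
    simpa [u] using hρJ (x i)
  have hu' : ∀ a ∈ MvPolynomial.idealOfVars σ L ^ (n + 1), u a = 0 := fun a ha => by
    have := Ideal.mem_map_of_mem u ha
    rw [Ideal.map_pow] at this
    simpa [hJ] using Ideal.pow_right_mono hu (n + 1) this
  let U : Q →ₐ[L] W := Ideal.Quotient.liftₐ _ u hu'
  have hUy : ∀ i, U (y i) = ρ (x i) - algebraMap L W (x i) := fun i => by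
    change u (MvPolynomial.X i) = _
    simp [u]
  have hUI : ∀ q ∈ I, U q ∈ J := fun q hq => by
    obtain ⟨a, ha, rfl⟩ := (Ideal.mem_map_iff_of_surjective _ Ideal.Quotient.mk_surjective).mp hq
    exact hu (Ideal.mem_map_of_mem u ha)
  have hUT : (U.restrictScalars K).comp T = ρ := by
    refine algHom_ext_of_formallyEtale hx ⟨n + 1, hJ⟩ (fun i => ?_) fun l => ?_
    · simp [hTx, hUy]
    · have h1 := J.sub_mem (hUI _ (hT l)) (hρJ l)
      simpa using h1
  have hUΦ : U.comp Φ = AlgHom.id L W := hext _ fun r => by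
    rw [AlgHom.comp_apply, hΦ, ← hρ, ← hUT]
    rfl
  refine ⟨AlgEquiv.ofAlgHom Φ U ?_ hUΦ⟩
  apply Ideal.Quotient.algHom_ext
  apply MvPolynomial.algHom_ext
  intro i
  change Φ (U (y i)) = y i
  rw [hUy, map_sub, hΦρ, hTx, Φ.commutes]
  exact add_sub_cancel_left _ _

end Coordinates

/-- Étale coordinates of the fraction field give the rank of `P^n` as the number of monomials of
degree at most `n`. -/
theorem genericRank_principalParts_of_formallyEtale [IsDomain R] {σ : Type*} [Fintype σ]
    {x : σ → FractionRing R} (hx : (MvPolynomial.aeval (R := K) x).toRingHom.FormallyEtale) :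
    genericRank R (PrincipalParts K R n) = ((n + Fintype.card σ).choose n : ℕ) := by
  let L := FractionRing R
  let W := L ⊗[R] PrincipalParts K R n
  let ι : PrincipalParts K R n →ₐ[R] W := Algebra.TensorProduct.includeRight
  obtain ⟨e⟩ : Nonempty (W ≃ₐ[L] MvPolynomial σ L ⧸ MvPolynomial.idealOfVars σ L ^ (n + 1)) := by
    refine nonempty_algEquiv_of_formallyEtale hx (J := (diagIdeal K R n).map ι) ?_
      ((ι.restrictScalars K).comp (univDiff K R n)) ?_ ?_ ?_
    · refine (Ideal.map_pow _ _ _).symm.trans ?_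
      rw [diagIdeal_pow, Ideal.map_bot]
    · intro r
      have h := Ideal.mem_map_of_mem ι (univDiff_sub_algebraMap_mem K R n r)
      rw [map_sub, ι.commutes, IsScalarTower.algebraMap_apply R L W] at h
      exact h
    · intro I T hI hT
      obtain ⟨φ, hφ⟩ := exists_algHom_principalParts hI T fun r => by
        rw [IsScalarTower.algebraMap_apply R L]
        exact hT r
      refine ⟨Algebra.TensorProduct.lift (Algebra.ofId L _) φ fun _ _ => Commute.all _ _,
        fun r => ?_⟩
      rw [← hφ]
      exact (Algebra.TensorProduct.lift_tmul _ _ _ _ _).trans (by simp)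
    · intro Ψ hΨ
      apply Algebra.TensorProduct.ext
      · ext
      · apply Ideal.Quotient.algHom_ext
        apply Algebra.TensorProduct.ext
        · ext
        · ext r
          exact hΨ r
  have h := congrArg Cardinal.toENat e.toLinearEquiv.lift_rank_eq
  rw [rank_quotient_pow_idealOfVars, Cardinal.toENat_lift] at h
  exact h.trans (by simp)

end GenericRank

/-! ### Étale coordinates from separable generation -/

section SeparableGeneration

open scoped IntermediateField.algebraAdjoinAdjoin in
/-- A separating transcendence basis is an étale coordinate system: the extension is a localization
of the polynomial ring followed by a separable algebraic extension. -/
theorem formallyEtale_aeval_of_isSeparable {K E ι : Type*} [Field K] [Field E] [Algebra K E]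
    {x : ι → E} (hx : AlgebraicIndependent K x)
    [Algebra.IsSeparable (IntermediateField.adjoin K (Set.range x)) E] :
    (MvPolynomial.aeval (R := K) x).toRingHom.FormallyEtale := by
  let A := Algebra.adjoin K (Set.range x)
  let F := IntermediateField.adjoin K (Set.range x)
  have h1 : Algebra.FormallyEtale A F := Algebra.FormallyEtale.of_isLocalization (nonZeroDivisors A)
  have h2 : Algebra.FormallyEtale F E := Algebra.FormallyEtale.of_isSeparable F E
  have h3 : Algebra.FormallyEtale A E := Algebra.FormallyEtale.comp A F E
  have h4 : hx.aevalEquiv.toRingEquiv.toRingHom.FormallyEtale := by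
    let := hx.aevalEquiv.toRingEquiv.toRingHom.toAlgebra
    exact Algebra.FormallyEtale.of_equiv
      { hx.aevalEquiv.toRingEquiv with commutes' := fun _ => rfl }
  have h5 := h4.comp (RingHom.formallyEtale_algebraMap.mpr h3)
  convert h5 using 1
  exact RingHom.ext fun p => (hx.algebraMap_aevalEquiv p).symm

/-- The fraction field of a domain essentially of finite type over `K` has a finite étale
coordinate system as soon as it is separable over `K`. -/
theorem exists_formallyEtale_of_isSeparableExtension {K R : Type*} [Field K] [CommRing R]
    [IsDomain R] [Algebra K R] [Algebra.EssFiniteType K R]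
    (h : IsSeparableExtension K (FractionRing R)) :
    ∃ (t : ℕ) (x : Fin t → FractionRing R),
      (MvPolynomial.aeval (R := K) x).toRingHom.FormallyEtale ∧ Algebra.trdeg K R = t := by
  have : Algebra.EssFiniteType K (FractionRing R) :=
    have : Algebra.EssFiniteType R (FractionRing R) :=
      Algebra.EssFiniteType.of_isLocalization _ (nonZeroDivisors R)
    Algebra.EssFiniteType.comp K R _
  obtain ⟨s, hs, hsep⟩ := h ⊤ (IntermediateField.fg_top K _)
  let e := IntermediateField.topEquiv (F := K) (E := FractionRing R)
  have htr : Algebra.trdeg K (FractionRing R) = Algebra.trdeg K R := by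
    have : Algebra.IsAlgebraic R (FractionRing R) :=
      IsLocalization.isAlgebraic _ (nonZeroDivisors R)
    rw [← trdeg_add_eq K R (A := FractionRing R), trdeg_eq_zero (R := R), add_zero]
  have hcard : Cardinal.mk s = Algebra.trdeg K R := by
    rw [hs.cardinalMk_eq_trdeg, e.trdeg_eq, htr]
  obtain ⟨t, ht⟩ := Cardinal.lt_aleph0.mp (htr.symm.trans_lt (trdeg_lt_aleph0 K (FractionRing R)))
  have hst : Cardinal.mk s = t := hcard.trans ht
  have : Finite s := Cardinal.lt_aleph0_iff_finite.mp (hst ▸ Cardinal.natCast_lt_aleph0)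
  have hts : t = Nat.card s := by simpa [Nat.card] using (congrArg Cardinal.toNat hst).symm
  have f : Fin t ≃ s := (finCongr hts).trans (Finite.equivFin s).symm
  have hx : AlgebraicIndependent K fun i => (f i : (⊤ : IntermediateField K (FractionRing R))) :=
    hs.1.comp f f.injective
  have hrange : Set.range (fun i => (f i : (⊤ : IntermediateField K (FractionRing R)))) = s := by
    rw [← Function.comp_def Subtype.val f, f.surjective.range_comp, Subtype.range_coe]
  rw [← hrange] at hsep
  have h1 := formallyEtale_aeval_of_isSeparable hx
  have h2 : e.toRingEquiv.toRingHom.FormallyEtale := by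
    let := e.toRingEquiv.toRingHom.toAlgebra
    exact Algebra.FormallyEtale.of_equiv { e.toRingEquiv with commutes' := fun _ => rfl }
  refine ⟨t, fun i => e (f i), ?_, ht⟩
  convert h1.comp h2 using 1
  ext p <;> simp

end SeparableGeneration

/-! ### Differential operators as functionals on principal parts -/

section Duality

variable {K R : Type*} [Field K] [CommRing R] [Algebra K R]

/-- An `R`-linear map vanishes on `Δ * I` as soon as it vanishes on the products with the generators
`1 ⊗ r - r ⊗ 1` of `Δ` as a left `R`-module. -/
theorem forall_mem_ideal_mul_iff (f : R ⊗[K] R →ₗ[R] R) (I : Ideal (R ⊗[K] R)) :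
    (∀ z ∈ KaehlerDifferential.ideal K R * I, f z = 0) ↔
      ∀ r : R, ∀ z ∈ I, f ((1 ⊗ₜ r - r ⊗ₜ 1) * z) = 0 := by
  constructor
  · intro h r z hz
    exact h _ (Ideal.mul_mem_mul (KaehlerDifferential.one_smul_sub_smul_one_mem_ideal K r) hz)
  · intro h z hz
    refine Submodule.mul_induction_on hz (fun d hd z hz => ?_) fun d e hd he => by
      rw [map_add, hd, he, add_zero]
    rw [← Submodule.restrictScalars_mem R (KaehlerDifferential.ideal K R),
      ← KaehlerDifferential.submodule_span_range_eq_ideal] at hd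
    induction hd using Submodule.span_induction with
    | mem d hd =>
      obtain ⟨r, rfl⟩ := hd
      exact h r z hz
    | zero => simp
    | add d e _ _ hd he => rw [add_mul, map_add, hd, he, add_zero]
    | smul a d _ hd => rw [smul_mul_assoc, map_smul, hd, smul_zero]

theorem liftBaseChange_diag_mul (δ : R →ₗ[K] R) (r : R) (z : R ⊗[K] R) :
    δ.liftBaseChange R ((1 ⊗ₜ r - r ⊗ₜ 1) * z) = (commutator K R δ r).liftBaseChange R z := by
  induction z with
  | zero => simp
  | tmul a b =>
    simp [sub_mul, LinearMap.liftBaseChange_tmul]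
    ring
  | add x y hx hy => rw [mul_add, map_add, map_add, hx, hy]

/-- The differential operators of order at most `n` are the `K`-linear maps whose `R`-linear
extension to `R ⊗ R` vanishes on `Δ ^ (n + 1)`. -/
theorem mem_diffOp_iff {n : ℕ} {δ : R →ₗ[K] R} :
    δ ∈ diffOp K R n ↔ ∀ z ∈ KaehlerDifferential.ideal K R ^ (n + 1), δ.liftBaseChange R z = 0 := by
  induction n generalizing δ with
  | zero =>
    rw [zero_add, pow_one, ← mul_one (KaehlerDifferential.ideal K R), forall_mem_ideal_mul_iff]
    simp only [liftBaseChange_diag_mul, mem_diffOp_zero]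
    refine forall_congr' fun r => ?_
    constructor
    · intro h z _
      have : commutator K R δ r = 0 := by
        ext x
        simp [h]
      simp [this]
    · intro h x
      have := h (1 ⊗ₜ x) (by simp)
      simpa [sub_eq_zero] using this
  | succ n ih =>
    rw [pow_succ', forall_mem_ideal_mul_iff, mem_diffOp_succ]
    simp only [liftBaseChange_diag_mul, ih]

/-- A differential operator of order at most `n` factors through a functional on `P^n`. -/
theorem exists_dual_of_mem_diffOp {n : ℕ} {δ : R →ₗ[K] R} (hδ : δ ∈ diffOp K R n) :
    ∃ φ : Module.Dual R (PrincipalParts K R n), ∀ f, φ (univDiff K R n f) = δ f := by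
  let I := KaehlerDifferential.ideal K R ^ (n + 1)
  refine ⟨((I.restrictScalars R).liftQ (δ.liftBaseChange R) (mem_diffOp_iff.mp hδ)).comp
    (Submodule.Quotient.restrictScalarsEquiv R I).symm.toLinearMap, fun f => ?_⟩
  change δ.liftBaseChange R (1 ⊗ₜ f) = _
  simp

theorem dual_comp_univDiff_mem_diffOp {n : ℕ} (φ : Module.Dual R (PrincipalParts K R n)) :
    (φ.restrictScalars K).comp (univDiff K R n).toLinearMap ∈ diffOp K R n := by
  rw [mem_diffOp_iff]
  intro z hz
  let q : R ⊗[K] R →ₗ[R] PrincipalParts K R n := (Ideal.Quotient.mkₐ R _).toLinearMap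
  have h : ((φ.restrictScalars K).comp (univDiff K R n).toLinearMap).liftBaseChange R =
      φ.comp q := by
    ext r
    simp [q, univDiff]
  rw [h, LinearMap.comp_apply]
  have : q z = 0 := Ideal.Quotient.eq_zero_iff_mem.mpr hz
  rw [this, map_zero]

end Duality

/-! ### Free rank and functionals modulo a maximal ideal -/

section FreeRank

variable {R M : Type*} [CommRing R] [AddCommGroup M] [Module R M] (m : Ideal R)

variable (M) in
/-- The elements of a module that every linear functional sends into `m`. -/
def nonUnimodular : Submodule R M :=
  ⨅ φ : Module.Dual R M, Submodule.comap φ m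

variable {m} in
theorem mem_nonUnimodular {x : M} :
    x ∈ nonUnimodular M m ↔ ∀ φ : Module.Dual R M, φ x ∈ m := by
  simp [nonUnimodular]

variable {m} in
theorem smul_mem_nonUnimodular {r : R} (hr : r ∈ m) (x : M) : r • x ∈ nonUnimodular M m :=
  mem_nonUnimodular.mpr fun φ => by
    rw [map_smul]
    exact m.mul_mem_right _ hr

/-- A free direct summand of rank `a` maps onto `(R / m) ^ a`, and this map kills
`nonUnimodular M m` because its coordinates are functionals. -/
theorem freeRank_le_length [m.IsMaximal] :
    freeRank R M ≤ Module.length R (M ⧸ nonUnimodular M m) := by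
  refine iSup₂_le fun a ⟨F, N, hFN, ⟨e⟩⟩ => ?_
  let π : M →ₗ[R] (Fin a → R) := e.toLinearMap.comp (F.projectionOnto N hFN)
  have hπ : Function.Surjective π :=
    e.surjective.comp (Submodule.projectionOnto_surjective hFN)
  let θ : M →ₗ[R] (Fin a → R ⧸ m) := (LinearMap.pi fun i => m.mkQ.comp (LinearMap.proj i)).comp π
  have hθ : Function.Surjective θ := by
    intro v
    choose w hw using fun i => Ideal.Quotient.mk_surjective (v i)
    obtain ⟨x, hx⟩ := hπ w
    refine ⟨x, funext fun i => ?_⟩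
    rw [← hw, ← hx]
    rfl
  have hle : nonUnimodular M m ≤ LinearMap.ker θ := fun x hx => by
    rw [LinearMap.mem_ker]
    ext i
    exact Ideal.Quotient.eq_zero_iff_mem.mpr
      (mem_nonUnimodular.mp hx ((LinearMap.proj i).comp π))
  have hsurj : Function.Surjective ((nonUnimodular M m).liftQ θ hle) := fun v => by
    obtain ⟨x, rfl⟩ := hθ v
    exact ⟨Submodule.Quotient.mk x, rfl⟩
  have := Module.length_le_of_surjective _ hsurj
  have hs : IsSimpleModule R (R ⧸ m) := isSimpleModule_iff_quot_maximal.mpr ⟨m, ‹_›, ⟨.refl _ _⟩⟩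
  rw [Module.length_pi_of_fintype] at this
  simpa using this

/-- Functionals and elements whose matrix of values is invertible split off a free summand. -/
theorem le_freeRank_of_isUnit_det {a : ℕ} (φ : Fin a → Module.Dual R M) (y : Fin a → M)
    (h : IsUnit (Matrix.of fun i j => φ i (y j)).det) : (a : ℕ∞) ≤ freeRank R M := by
  let A : Matrix (Fin a) (Fin a) R := Matrix.of fun i j => φ i (y j)
  let Φ : M →ₗ[R] (Fin a → R) := LinearMap.pi φ
  let Ψ : (Fin a → R) →ₗ[R] M := (Fintype.linearCombination R y).comp (Matrix.toLin' A⁻¹)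
  have hΦΨ : Φ ∘ₗ Ψ = LinearMap.id := by
    have : Φ ∘ₗ Fintype.linearCombination R y = Matrix.toLin' A := by
      apply LinearMap.pi_ext'
      intro j
      ext i
      simp [Φ, A, Fintype.linearCombination_apply_single]
    rw [← LinearMap.comp_assoc, this, ← Matrix.toLin'_mul, Matrix.mul_nonsing_inv _ h,
      Matrix.toLin'_one]
  have hinj : Function.Injective Ψ := fun u v huv => by
    have := congrArg Φ huv
    rwa [← LinearMap.comp_apply, ← LinearMap.comp_apply, hΦΨ] at this
  refine le_iSup₂_of_le a ⟨LinearMap.range Ψ, LinearMap.ker Φ, ?_,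
    ⟨(LinearEquiv.ofInjective Ψ hinj).symm⟩⟩ le_rfl
  have hid : ∀ v, Φ (Ψ v) = v := fun v => LinearMap.congr_fun hΦΨ v
  constructor
  · rw [Submodule.disjoint_def]
    rintro _ ⟨v, rfl⟩ hv
    rw [LinearMap.mem_ker, hid] at hv
    rw [hv, map_zero]
  · rw [codisjoint_iff, Submodule.eq_top_iff']
    intro x
    refine Submodule.mem_sup.mpr ⟨Ψ (Φ x), ⟨_, rfl⟩, x - Ψ (Φ x), ?_, add_sub_cancel _ _⟩
    rw [LinearMap.mem_ker, map_sub, hid, sub_self]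

/-- Elements that are linearly independent over `R / m` modulo `nonUnimodular M m` admit functionals
with values dual to them modulo `m`: otherwise the values of all functionals at these elements would
span a proper subspace of `(R / m) ^ a`, and a linear form vanishing on it would be a dependency. -/
theorem exists_dual_basis_mod [m.IsMaximal] {a : ℕ} (y : Fin a → M)
    (hy : ∀ r : Fin a → R, ∑ j, r j • y j ∈ nonUnimodular M m → ∀ j, r j ∈ m) :
    ∃ φ : Fin a → Module.Dual R M, ∀ i j, φ i (y j) - (if i = j then 1 else 0) ∈ m := by
  let _ := Ideal.Quotient.field m
  -- the value vectors, modulo `m`, of all functionals at the given elements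
  let W : Submodule (R ⧸ m) (Fin a → R ⧸ m) :=
    { carrier := {v | ∃ φ : Module.Dual R M, ∀ j, Ideal.Quotient.mk m (φ (y j)) = v j}
      add_mem' := by
        rintro u v ⟨φ, hφ⟩ ⟨ψ, hψ⟩
        exact ⟨φ + ψ, fun j => by simp [hφ, hψ]⟩
      zero_mem' := ⟨0, fun j => by simp⟩
      smul_mem' := by
        rintro c v ⟨φ, hφ⟩
        obtain ⟨c, rfl⟩ := Ideal.Quotient.mk_surjective c
        exact ⟨c • φ, fun j => by simp [hφ]⟩ }
  have hW : W = ⊤ := by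
    by_contra hne
    obtain ⟨f, hf0, hf⟩ := Submodule.exists_le_ker_of_lt_top W (lt_top_iff_ne_top.mpr hne)
    choose c hc using fun j => Ideal.Quotient.mk_surjective (I := m) (f (Pi.single j 1))
    have hfv : ∀ v, f v = ∑ j, v j * f (Pi.single j 1) := fun v => by
      rw [LinearMap.pi_apply_eq_sum_univ f v]
      refine Finset.sum_congr rfl fun j _ => ?_
      rw [smul_eq_mul]
      congr 2
      ext i
      simp [Pi.single_apply, eq_comm]
    apply hf0
    have hcm := hy c (mem_nonUnimodular.mpr fun φ => by
      have h1 : f (fun j => Ideal.Quotient.mk m (φ (y j))) = 0 := hf ⟨φ, fun _ => rfl⟩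
      rw [hfv] at h1
      rw [← Ideal.Quotient.eq_zero_iff_mem, map_sum, map_sum, ← h1]
      refine Finset.sum_congr rfl fun j _ => ?_
      rw [← hc, map_smul, smul_eq_mul, map_mul, mul_comm])
    refine LinearMap.ext fun v => ?_
    rw [hfv]
    simp [← hc, Ideal.Quotient.eq_zero_iff_mem.mpr (hcm _)]
  have hsurj : ∀ i, ∃ φ : Module.Dual R M, ∀ j,
      Ideal.Quotient.mk m (φ (y j)) = (Pi.single i 1 : Fin a → R ⧸ m) j := fun i =>
    (hW ▸ Submodule.mem_top : (Pi.single i 1 : Fin a → R ⧸ m) ∈ W)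
  choose φ hφ using hsurj
  refine ⟨φ, fun i j => ?_⟩
  rw [← Ideal.Quotient.eq, hφ]
  by_cases h : i = j <;> simp [h, eq_comm]

theorem det_sub_one_mem {a : ℕ} {A : Matrix (Fin a) (Fin a) R}
    (hA : ∀ i j, A i j - (if i = j then 1 else 0) ∈ m) : A.det - 1 ∈ m := by
  rw [← Ideal.Quotient.eq, RingHom.map_det, map_one]
  have : (Ideal.Quotient.mk m).mapMatrix A = 1 := by
    ext i j
    rw [RingHom.mapMatrix_apply, Matrix.map_apply, Ideal.Quotient.eq.mpr (hA i j),
      Matrix.one_apply]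
    split_ifs <;> simp
  rw [this, Matrix.det_one]

theorem exists_independent_of_le_length [m.IsMaximal] {a : ℕ}
    (ha : (a : ℕ∞) ≤ Module.length R (M ⧸ nonUnimodular M m)) :
    ∃ y : Fin a → M, ∀ r : Fin a → R, ∑ j, r j • y j ∈ nonUnimodular M m → ∀ j, r j ∈ m := by
  let _ := Ideal.Quotient.field m
  let V := M ⧸ nonUnimodular M m
  have hT : Module.IsTorsionBySet R V m := by
    rintro x ⟨r, hr⟩
    obtain ⟨x, rfl⟩ := Submodule.Quotient.mk_surjective _ x
    exact (Submodule.Quotient.mk_eq_zero _).mpr (smul_mem_nonUnimodular hr x)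
  let _ : Module (R ⧸ m) V := hT.module
  have : IsScalarTower R (R ⧸ m) V := hT.isScalarTower
  rw [Module.length_eq_of_surjective (S := R) (R := R ⧸ m) (M := V)
    Ideal.Quotient.mk_surjective, Module.length_eq_rank] at ha
  have ha' : (a : Cardinal) ≤ Module.rank (R ⧸ m) V := by simpa using ha
  obtain ⟨v, hv⟩ := Module.le_rank_iff.mp ha'
  choose y hy using fun j => Submodule.Quotient.mk_surjective _ (v j)
  refine ⟨y, fun r hr j => ?_⟩
  rw [← Ideal.Quotient.eq_zero_iff_mem]
  refine Fintype.linearIndependent_iff.mp hv (fun j => Ideal.Quotient.mk m (r j)) ?_ j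
  rw [← (Submodule.Quotient.mk_eq_zero _).mpr hr, ← Submodule.mkQ_apply, map_sum]
  refine Finset.sum_congr rfl fun j _ => ?_
  rw [map_smul, Submodule.mkQ_apply, hy]
  exact algebraMap_smul (R ⧸ m) (r j) (v j)

/-- Over a local ring, a matrix that is the identity modulo the maximal ideal is invertible, so a
dual basis modulo the maximal ideal splits off a free summand. -/
theorem length_le_freeRank_of_isLocalRing [IsLocalRing R] :
    Module.length R (M ⧸ nonUnimodular M (IsLocalRing.maximalIdeal R)) ≤ freeRank R M := by
  refine ENat.forall_natCast_le_iff_le.mp fun a ha => ?_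
  obtain ⟨y, hy⟩ := exists_independent_of_le_length _ ha
  obtain ⟨φ, hφ⟩ := exists_dual_basis_mod _ y hy
  refine le_freeRank_of_isUnit_det φ y ?_
  by_contra hu
  have h1 := det_sub_one_mem (IsLocalRing.maximalIdeal R)
    (A := Matrix.of fun i j => φ i (y j)) hφ
  have h2 := Ideal.sub_mem _ ((IsLocalRing.mem_maximalIdeal _).mpr hu) h1
  rw [sub_sub_cancel] at h2
  exact (Ideal.ne_top_iff_one _).mp (IsLocalRing.maximalIdeal.isMaximal R).ne_top h2

end FreeRank

/-! ### Principal parts modulo the maximal ideal -/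

section Surjectivity

variable {K R : Type*} [Field K] [CommRing R] [Algebra K R] (m : Ideal R) (n : ℕ)

theorem sup_pow_le_pow_sup {A : Type*} [CommRing A] (I J : Ideal A) (k : ℕ) :
    (I ⊔ J) ^ k ≤ I ^ k ⊔ J := by
  induction k with
  | zero => simp
  | succ k ih =>
    rw [pow_succ]
    refine (Ideal.mul_mono_left ih).trans ?_
    rw [Ideal.sup_mul, Ideal.mul_sup, ← pow_succ]
    exact sup_le (sup_le le_sup_left (Ideal.mul_le_right.trans le_sup_right))
      (Ideal.mul_le_left.trans le_sup_right)

theorem univDiff_mem_sup {r : R} (hr : r ∈ m) :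
    univDiff K R n r ∈ diagIdeal K R n ⊔ m.map (algebraMap R (PrincipalParts K R n)) := by
  rw [← sub_add_cancel (univDiff K R n r) (algebraMap R _ r)]
  exact add_mem (Ideal.mem_sup_left (univDiff_sub_algebraMap_mem K R n r))
    (Ideal.mem_sup_right (Ideal.mem_map_of_mem _ hr))

/-- `univDiff` need not map `m` into `m P^n`, but it does so modulo `Δ`, and `Δ ^ (n + 1) = 0` in
`P^n`. -/
theorem map_univDiff_pow_le :
    (m ^ (n + 1)).map (univDiff K R n) ≤ m.map (algebraMap R (PrincipalParts K R n)) := by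
  rw [Ideal.map_pow]
  have h : m.map (univDiff K R n) ≤
      diagIdeal K R n ⊔ m.map (algebraMap R (PrincipalParts K R n)) :=
    Ideal.map_le_iff_le_comap.mpr fun r hr => univDiff_mem_sup m n hr
  refine (Ideal.pow_right_mono h _).trans ?_
  refine (sup_pow_le_pow_sup _ _ _).trans ?_
  rw [diagIdeal_pow, bot_sup_eq]

/-- Let `r` be a `K`-algebra map on `R` that agrees with the structure map of an `R`-algebra `S`
modulo a nilpotent ideal. If `S` is killed by `m` and `R / m` is separable over `K`, the range of
`r` contains the image of `R`: a section of `R / m ^ (k + 1) → R / m` exists because `R / m` is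
formally étale over `K`, and its composite with `r` is the structure map because `R / m` is formally
unramified over `K`. -/
theorem algebraMap_mem_range_of_sub_mem [m.IsMaximal] [Algebra.IsSeparable K (R ⧸ m)]
    {S : Type*} [CommRing S] [Algebra R S] [Algebra K S] [IsScalarTower K R S] {D : Ideal S}
    {k : ℕ} (hD : D ^ (k + 1) = ⊥) (r : R →ₐ[K] S) (hrD : ∀ a, r a - algebraMap R S a ∈ D)
    (halg : ∀ a ∈ m, algebraMap R S a = 0) (a : R) : algebraMap R S a ∈ r.range := by
  have hrm : ∀ a ∈ m ^ (k + 1), r a = 0 := fun a ha => by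
    have hm : m.map r ≤ D := Ideal.map_le_iff_le_comap.mpr fun a ha => by
      simpa [halg a ha] using hrD a
    have h := Ideal.mem_map_of_mem r ha
    rw [Ideal.map_pow] at h
    simpa [hD] using Ideal.pow_right_mono hm (k + 1) h
  let _ := Ideal.Quotient.field m
  have : Algebra.FormallyEtale K (R ⧸ m) := Algebra.FormallyEtale.of_isSeparable K (R ⧸ m)
  let g : R ⧸ m ^ (k + 1) →ₐ[K] R ⧸ m :=
    Ideal.Quotient.factorₐ K (Ideal.pow_le_self (Nat.succ_ne_zero k))
  have hg : Function.Surjective g := Ideal.Quotient.factor_surjective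
    (Ideal.pow_le_self (Nat.succ_ne_zero k))
  have hker : IsNilpotent (RingHom.ker g) := by
    refine ⟨k + 1, ?_⟩
    have : RingHom.ker g = m.map (Ideal.Quotient.mk (m ^ (k + 1))) := Ideal.Quotient.factor_ker
      (Ideal.pow_le_self (Nat.succ_ne_zero k))
    rw [this, ← Ideal.map_pow, Ideal.map_quotient_self]
    rfl
  let τ : R ⧸ m →ₐ[K] R ⧸ m ^ (k + 1) :=
    Algebra.FormallySmooth.liftOfSurjective (AlgHom.id K _) g hg hker
  have hτ : ∀ c, g (τ c) = c := fun c =>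
    Algebra.FormallySmooth.liftOfSurjective_apply (AlgHom.id K _) g hg hker c
  let rbar : R ⧸ m ^ (k + 1) →ₐ[K] S := Ideal.Quotient.liftₐ _ r hrm
  let l : R ⧸ m →ₐ[K] S := Ideal.Quotient.liftₐ _ (IsScalarTower.toAlgHom K R S) halg
  have hl : rbar.comp τ = l := by
    refine Algebra.FormallyUnramified.ext D ⟨k + 1, hD⟩ fun c => ?_
    rw [Ideal.Quotient.eq]
    obtain ⟨a, rfl⟩ := Ideal.Quotient.mk_surjective c
    obtain ⟨b, hb⟩ := Ideal.Quotient.mk_surjective (τ (Ideal.Quotient.mk m a))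
    have hba : b - a ∈ m := by
      rw [← Ideal.Quotient.eq, ← hτ (Ideal.Quotient.mk m a), ← hb]
      rfl
    have h1 : (rbar.comp τ) (Ideal.Quotient.mk m a) = r b := by
      rw [AlgHom.comp_apply, ← hb]
      rfl
    have h2 : l (Ideal.Quotient.mk m a) = algebraMap R S a := rfl
    rw [h1, h2, ← sub_eq_zero.mp ((map_sub (algebraMap R S) b a).symm.trans (halg _ hba))]
    exact hrD b
  obtain ⟨b, hb⟩ := Ideal.Quotient.mk_surjective (τ (Ideal.Quotient.mk m a))
  refine ⟨b, ?_⟩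
  have := DFunLike.congr_fun hl (Ideal.Quotient.mk m a)
  rw [AlgHom.comp_apply, ← hb] at this
  exact this

/-- The universal differential operator maps `R` onto `P^n / m P^n`. -/
theorem exists_univDiff_sub_mem [m.IsMaximal] [Algebra.IsSeparable K (R ⧸ m)]
    (z : PrincipalParts K R n) :
    ∃ f : R, univDiff K R n f - z ∈ m.map (algebraMap R (PrincipalParts K R n)) := by
  let mP := m.map (algebraMap R (PrincipalParts K R n))
  let q : PrincipalParts K R n →ₐ[R] PrincipalParts K R n ⧸ mP := Ideal.Quotient.mkₐ R mP
  let r : R →ₐ[K] PrincipalParts K R n ⧸ mP := (Ideal.Quotient.mkₐ K mP).comp (univDiff K R n)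
  have hrange : ∀ a, q (algebraMap R (PrincipalParts K R n) a) ∈ r.range := by
    intro a
    rw [q.commutes]
    refine algebraMap_mem_range_of_sub_mem m (k := n)
      (D := (diagIdeal K R n).map (Ideal.Quotient.mk mP)) ?_ r (fun a => ?_) (fun a ha => ?_) a
    · rw [← Ideal.map_pow, diagIdeal_pow, Ideal.map_bot]
    · exact Ideal.mem_map_of_mem _ (univDiff_sub_algebraMap_mem K R n a)
    · exact Ideal.Quotient.eq_zero_iff_mem.mpr (Ideal.mem_map_of_mem _ ha)
  have hsurj : ∀ z, q z ∈ r.range := by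
    intro p
    obtain ⟨w, rfl⟩ := Ideal.Quotient.mk_surjective p
    induction w with
    | zero => simp
    | add x y hx hy => rw [map_add, map_add]; exact add_mem hx hy
    | tmul a b =>
      have : q (Ideal.Quotient.mk _ (a ⊗ₜ b)) =
          q (algebraMap R (PrincipalParts K R n) a) * r b := by
        have h : a ⊗ₜ[K] b = algebraMap R (R ⊗[K] R) a * (1 ⊗ₜ b) := by simp
        rw [h, map_mul, map_mul]
        rfl
      rw [this]
      exact mul_mem (hrange a) ⟨b, rfl⟩
  obtain ⟨f, hf⟩ := hsurj z
  exact ⟨f, Ideal.Quotient.eq.mp hf⟩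

end Surjectivity

/-! ### Length over a coefficient field -/

section Length

universe u

variable {R : Type u} [CommRing R] (m : Ideal R) [m.IsMaximal]

theorem isLocalRing_quotient_pow {n : ℕ} (hn : n ≠ 0) : IsLocalRing (R ⧸ m ^ n) := by
  have hle : m ^ n ≤ m := Ideal.pow_le_self hn
  refine IsLocalRing.of_unique_max_ideal ⟨m.map (Ideal.Quotient.mk (m ^ n)), ?_, fun I hI => ?_⟩
  · exact Ideal.IsMaximal.map_of_surjective_of_ker_le Ideal.Quotient.mk_surjective
      (by rwa [Ideal.mk_ker])
  · have hI' : (I.comap (Ideal.Quotient.mk (m ^ n))).IsMaximal :=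
      Ideal.comap_isMaximal_of_surjective _ Ideal.Quotient.mk_surjective
    have hmI : m = I.comap (Ideal.Quotient.mk (m ^ n)) := by
      refine Ideal.IsMaximal.eq_of_le ‹_› hI'.ne_top (Ideal.IsPrime.le_of_pow_le (n := n) ?_)
      intro r hr
      rw [Ideal.mem_comap, Ideal.Quotient.eq_zero_iff_mem.mpr hr]
      exact I.zero_mem
    refine (Ideal.map_comap_of_surjective _ Ideal.Quotient.mk_surjective I).symm.trans ?_
    rw [← hmI]

/-- A module over `R` that is killed by a power of the maximal ideal `m` has dimension over `K`
equal to its length times the degree of the residue field. -/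
theorem length_eq_length_mul {K : Type*} [Field K] [Algebra K R] {M : Type u} [AddCommGroup M]
    [Module R M] [Module K M] [IsScalarTower K R M] {n : ℕ}
    (hM : ∀ r ∈ m ^ (n + 1), ∀ x : M, r • x = 0) :
    Module.length K M = Module.length R M * Module.length K (R ⧸ m) := by
  -- the length formula for restriction of scalars is applied over the local ring `R / m ^ (n + 1)`
  let B := R ⧸ m ^ (n + 1)
  have : IsLocalRing B := isLocalRing_quotient_pow m (Nat.succ_ne_zero n)
  have key : ∀ (N : Type u) [AddCommGroup N] [Module R N] [Module K N] [IsScalarTower K R N],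
      (∀ r ∈ m ^ (n + 1), ∀ x : N, r • x = 0) → Module.length K N = Module.length R N *
        Module.length (IsLocalRing.ResidueField K) (IsLocalRing.ResidueField B) := by
    intro N _ _ _ _ hN
    have hT : Module.IsTorsionBySet R N (m ^ (n + 1) : Ideal R) := fun x r => hN r.1 r.2 x
    let _ : Module B N := hT.module
    have : IsScalarTower R B N := hT.isScalarTower
    have : IsScalarTower K B N := IsScalarTower.of_algebraMap_smul fun c x => by
      rw [IsScalarTower.algebraMap_apply K R B, algebraMap_smul, algebraMap_smul]
    rw [IsLocalRing.length_restrictScalars K B N,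
      Module.length_eq_of_surjective (S := R) (R := B) (M := N) Ideal.Quotient.mk_surjective]
  have hs : IsSimpleModule R (R ⧸ m) := isSimpleModule_iff_quot_maximal.mpr ⟨m, ‹_›, ⟨.refl _ _⟩⟩
  rw [key (R ⧸ m), key M hM, Module.length_eq_one R (R ⧸ m), one_mul]
  intro r hr x
  obtain ⟨a, rfl⟩ := Ideal.Quotient.mk_surjective x
  exact Ideal.Quotient.eq_zero_iff_mem.mpr
    (m.mul_mem_right a (Ideal.pow_le_self (Nat.succ_ne_zero n) hr))

end Length

/-! ### Differential powers and principal parts -/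

section DifferentialPower

variable {K R : Type*} [Field K] [CommRing R] [Algebra K R] (m : Ideal R) (n : ℕ)

/-- The differential power is the preimage of `nonUnimodular` under `univDiff`, because operators of
order at most `n` are the same as functionals on `P^n`. -/
theorem mem_diffPower_succ_iff {f : R} :
    f ∈ diffPower K m (n + 1) ↔
      univDiff K R n f ∈ nonUnimodular (PrincipalParts K R n) m := by
  rw [mem_nonUnimodular]
  constructor
  · intro h φ
    exact h _ (dual_comp_univDiff_mem_diffOp φ)
  · intro h δ hδ
    obtain ⟨φ, hφ⟩ := exists_dual_of_mem_diffOp hδ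
    rw [← hφ]
    exact h φ

theorem map_le_nonUnimodular {z : PrincipalParts K R n}
    (hz : z ∈ m.map (algebraMap R (PrincipalParts K R n))) :
    z ∈ nonUnimodular (PrincipalParts K R n) m := by
  induction hz using Submodule.span_induction with
  | mem z hz =>
    obtain ⟨r, hr, rfl⟩ := hz
    rw [Algebra.algebraMap_eq_smul_one]
    exact smul_mem_nonUnimodular hr _
  | zero => exact zero_mem _
  | add x y _ _ hx hy => exact add_mem hx hy
  | smul w z _ hz =>
    rw [mem_nonUnimodular] at hz ⊢
    exact fun φ => hz (φ.comp (LinearMap.mulLeft R w))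

/-- The length of `R / m^{<n+1>}` is the length of the quotient of `P^n` by its elements that every
functional sends into `m`: `univDiff` induces a `K`-linear isomorphism between the two quotients,
since it maps `R` onto `P^n / m P^n`. -/
theorem length_quotient_diffPower [m.IsMaximal] [Module.Finite K (R ⧸ m)]
    [Algebra.IsSeparable K (R ⧸ m)] :
    Module.length R (R ⧸ diffPower K m (n + 1)) =
      Module.length R (PrincipalParts K R n ⧸ nonUnimodular (PrincipalParts K R n) m) := by
  let N := nonUnimodular (PrincipalParts K R n) m
  let f : R →ₗ[K] PrincipalParts K R n ⧸ N :=
    (N.mkQ.restrictScalars K).comp (univDiff K R n).toLinearMap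
  have hf : Function.Surjective f := fun v => by
    obtain ⟨z, rfl⟩ := Submodule.Quotient.mk_surjective _ v
    obtain ⟨r, hr⟩ := exists_univDiff_sub_mem m n z
    exact ⟨r, (Submodule.Quotient.eq _).mpr (map_le_nonUnimodular m n hr)⟩
  have hker : LinearMap.ker f = (diffPower K m (n + 1)).restrictScalars K := by
    ext r
    rw [Submodule.restrictScalars_mem, mem_diffPower_succ_iff, LinearMap.mem_ker]
    exact Submodule.Quotient.mk_eq_zero _
  have e : (R ⧸ diffPower K m (n + 1)) ≃ₗ[K] PrincipalParts K R n ⧸ N :=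
    (Submodule.Quotient.restrictScalarsEquiv K _).symm.trans
      ((Submodule.quotEquivOfEq _ _ hker.symm).trans (f.quotKerEquivOfSurjective hf))
  have h1 := length_eq_length_mul m (K := K) (M := R ⧸ diffPower K m (n + 1)) (n := n) (by
    intro r hr x
    obtain ⟨a, rfl⟩ := Ideal.Quotient.mk_surjective x
    refine Ideal.Quotient.eq_zero_iff_mem.mpr (Ideal.mul_mem_right a _ ?_)
    rw [mem_diffPower_succ_iff]
    exact map_le_nonUnimodular m n (map_univDiff_pow_le m n (Ideal.mem_map_of_mem _ hr)))
  have h2 := length_eq_length_mul m (K := K) (M := PrincipalParts K R n ⧸ N) (n := n) (by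
    intro r hr x
    obtain ⟨z, rfl⟩ := Submodule.Quotient.mk_surjective _ x
    exact (Submodule.Quotient.mk_eq_zero _).mpr
      (smul_mem_nonUnimodular (Ideal.pow_le_self (Nat.succ_ne_zero n) hr) z))
  rw [← e.length_eq, h1] at h2
  -- the degree of the residue field is positive and finite, so it cancels
  have h3 : Module.length K (R ⧸ m) ≠ 0 := Module.length_pos.ne'
  have h4 : Module.length K (R ⧸ m) ≠ ⊤ := Module.length_ne_top
  exact (ENat.mul_left_strictMono h3 h4).injective h2

end DifferentialPower

/-! ### Homogeneous operators on graded algebras -/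

section Graded

variable {K R : Type*} [Field K] [CommRing R] [Algebra K R] (𝒜 : ℕ → Submodule K R)
  [GradedAlgebra 𝒜]

/-- The projection of a graded algebra onto its component of degree `j ∈ ℤ`, which is zero for
negative `j`. Integer degrees let operators lower the degree. -/
noncomputable def projInt (j : ℤ) : R →ₗ[K] R :=
  if 0 ≤ j then GradedAlgebra.proj 𝒜 j.toNat else 0

/-- The component of degree `e ∈ ℤ` of an endomorphism `δ` of a graded algebra: on the elements of
degree `i` it is `δ` followed by the projection to degree `i + e`. -/
noncomputable def homogComponent (δ : R →ₗ[K] R) (e : ℤ) : R →ₗ[K] R :=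
  (DirectSum.toModule K ℕ R fun i => (projInt 𝒜 (i + e)).comp (δ.comp (𝒜 i).subtype)).comp
    (DirectSum.decomposeLinearEquiv 𝒜).toLinearMap

variable {𝒜}

theorem homogComponent_of_mem (δ : R →ₗ[K] R) (e : ℤ) {i : ℕ} {x : R} (hx : x ∈ 𝒜 i) :
    homogComponent 𝒜 δ e x = projInt 𝒜 (i + e) (δ x) := by
  simp only [homogComponent, LinearMap.comp_apply, LinearEquiv.coe_coe,
    DirectSum.decomposeLinearEquiv_apply]
  rw [DirectSum.decompose_of_mem 𝒜 hx]
  exact DirectSum.toModule_lof K i _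

theorem projInt_mul {c : ℕ} {r : R} (hr : r ∈ 𝒜 c) (j : ℤ) (x : R) :
    projInt 𝒜 (c + j) (r * x) = r * projInt 𝒜 j x := by
  unfold projInt
  split_ifs with h1 h2 h2
  · obtain ⟨k, rfl⟩ := Int.eq_ofNat_of_zero_le h2
    have : ((c : ℤ) + k).toNat = c + k := by lia
    rw [this, GradedAlgebra.proj_apply, GradedAlgebra.proj_apply,
      DirectSum.coe_decompose_mul_add_of_left_mem 𝒜 hr]
    rfl
  · rw [GradedAlgebra.proj_apply, DirectSum.coe_decompose_mul_of_left_mem_of_not_le 𝒜 hr (by lia)]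
    simp
  · lia
  · simp

theorem linearMap_ext_homogeneous {f g : R →ₗ[K] R} (h : ∀ i, ∀ x ∈ 𝒜 i, f x = g x) : f = g := by
  ext x
  induction x using DirectSum.Decomposition.inductionOn 𝒜 with
  | zero => simp
  | homogeneous x => exact h _ _ x.2
  | add x y hx hy => rw [map_add, map_add, hx, hy]

/-- The commutator with a homogeneous element of degree `c` shifts homogeneous components by `c`. -/
theorem commutator_homogComponent (δ : R →ₗ[K] R) (e : ℤ) {c : ℕ} {r : R} (hr : r ∈ 𝒜 c) :
    commutator K R (homogComponent 𝒜 δ e) r =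
      homogComponent 𝒜 (commutator K R δ r) (c + e) := by
  refine linearMap_ext_homogeneous (𝒜 := 𝒜) fun i x hx => ?_
  have h1 : ((c + i : ℕ) : ℤ) + e = c + (i + e) := by push_cast; ring
  have h2 : (i : ℤ) + (c + e) = c + (i + e) := by ring
  rw [commutator_apply, homogComponent_of_mem δ e hx, homogComponent_of_mem _ _ hx,
    homogComponent_of_mem δ e (SetLike.mul_mem_graded hr hx), commutator_apply, map_sub, h1, h2,
    projInt_mul hr]

theorem forall_commutator_mem (δ : R →ₗ[K] R) (D : Submodule R (R →ₗ[K] R))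
    (h : ∀ c, ∀ r ∈ 𝒜 c, commutator K R δ r ∈ D) (r : R) : commutator K R δ r ∈ D := by
  induction r using DirectSum.Decomposition.inductionOn 𝒜 with
  | zero =>
    have : commutator K R δ 0 = 0 := by ext x; simp
    rw [this]
    exact D.zero_mem
  | homogeneous x => exact h _ _ x.2
  | add r s hr hs =>
    have : commutator K R δ (r + s) = commutator K R δ r + commutator K R δ s := by
      ext x
      simp only [commutator_apply, add_mul, map_add, LinearMap.add_apply]
      ring
    rw [this]
    exact D.add_mem hr hs

/-- The homogeneous components of a differential operator are differential operators of at most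
the same order. -/
theorem homogComponent_mem_diffOp {n : ℕ} {δ : R →ₗ[K] R} (hδ : δ ∈ diffOp K R n) (e : ℤ) :
    homogComponent 𝒜 δ e ∈ diffOp K R n := by
  induction n generalizing δ e with
  | zero =>
    have key : ∀ r, commutator K R (homogComponent 𝒜 δ e) r ∈
        (⊥ : Submodule R (R →ₗ[K] R)) := by
      refine forall_commutator_mem (𝒜 := 𝒜) _ _ fun c r hr => ?_
      have h0 : commutator K R δ r = 0 := by
        ext x
        rw [commutator_apply, hδ r x, sub_self, LinearMap.zero_apply]
      rw [commutator_homogComponent δ e hr, h0, Submodule.mem_bot]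
      exact linearMap_ext_homogeneous (𝒜 := 𝒜) fun i x hx => by
        rw [homogComponent_of_mem _ _ hx]
        simp
    intro r x
    have := LinearMap.congr_fun ((Submodule.mem_bot _).mp (key r)) x
    rwa [commutator_apply, LinearMap.zero_apply, sub_eq_zero] at this
  | succ n ih =>
    rw [mem_diffOp_succ] at hδ ⊢
    refine forall_commutator_mem (𝒜 := 𝒜) _ _ fun c r hr => ?_
    rw [commutator_homogComponent δ e hr]
    exact ih (hδ r) _

theorem exists_homogeneous_linearIndependent (J : Submodule K R) {a : ℕ}
    (ha : (a : Cardinal) ≤ Module.rank K (R ⧸ J)) :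
    ∃ (d : Fin a → ℕ) (f : Fin a → R), (∀ j, f j ∈ 𝒜 (d j)) ∧
      LinearIndependent K fun j => J.mkQ (f j) := by
  let S : Set (R ⧸ J) := {v | ∃ i, ∃ x ∈ 𝒜 i, J.mkQ x = v}
  have hS : Submodule.span K S = ⊤ := by
    rw [Submodule.eq_top_iff']
    intro v
    obtain ⟨x, rfl⟩ := Submodule.Quotient.mk_surjective _ v
    change J.mkQ x ∈ _
    induction x using DirectSum.Decomposition.inductionOn 𝒜 with
    | zero => simp
    | homogeneous x => exact Submodule.subset_span ⟨_, x, x.2, rfl⟩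
    | add x y hx hy => rw [map_add]; exact add_mem hx hy
  obtain ⟨b, hbS, hspan, hb⟩ := exists_linearIndependent K S
  have hrank : Module.rank K (R ⧸ J) = Cardinal.mk b :=
    ((Module.Basis.mk hb (by simp [hspan, hS])).mk_eq_rank'').symm
  obtain ⟨ι⟩ : Nonempty (Fin a ↪ b) := Cardinal.lift_mk_le'.mp (by simpa [hrank] using ha)
  choose d f hf hfb using fun j => hbS (ι j).2
  refine ⟨d, f, hf, ?_⟩
  simp only [hfb]
  exact hb.comp ι ι.injective

/-- If the entries of a matrix are homogeneous of degrees `d j - d i`, its determinant is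
homogeneous of degree zero, hence a constant; as `K` is a field, it is invertible if it is `1`
modulo `m`. -/
theorem isUnit_det_of_homogeneous (h0 : 𝒜 0 = LinearMap.range (Algebra.linearMap K R))
    {m : Ideal R} (hm : m ≠ ⊤) {a : ℕ} (d : Fin a → ℕ) {A : Matrix (Fin a) (Fin a) R}
    (hA : ∀ i j, A i j ∈ LinearMap.range (projInt 𝒜 ((d j : ℤ) - d i)))
    (hdet : A.det - 1 ∈ m) : IsUnit A.det := by
  have hdet0 : A.det ∈ 𝒜 0 := by
    rw [Matrix.det_apply]
    refine Submodule.sum_mem _ fun σ _ => ?_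
    refine zsmul_mem ?_ _
    by_cases hle : ∀ i ∈ Finset.univ, d (σ i) ≤ d i
    · -- the degrees of the factors are nonnegative and add up to zero
      have hsum : ∑ i, d (σ i) = ∑ i, d i := Equiv.sum_comp σ d
      have heq := (Finset.sum_eq_sum_iff_of_le hle).mp hsum
      refine prod_mem (S := SetLike.GradeZero.subring 𝒜) fun i _ => ?_
      obtain ⟨x, hx⟩ := hA (σ i) i
      rw [← hx, heq i (Finset.mem_univ i), sub_self]
      have : projInt 𝒜 0 x ∈ 𝒜 0 := by simp [projInt]
      exact this
    · push Not at hle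
      obtain ⟨i, -, hi⟩ := hle
      have : A (σ i) i = 0 := by
        obtain ⟨x, hx⟩ := hA (σ i) i
        rw [← hx, projInt, if_neg (by lia), LinearMap.zero_apply]
      rw [Finset.prod_eq_zero (f := fun i => A (σ i) i) (Finset.mem_univ i) this]
      exact zero_mem _
  rw [h0] at hdet0
  obtain ⟨c, hc⟩ := hdet0
  rw [← hc, Algebra.linearMap_apply]
  refine (IsUnit.mk0 c ?_).map _
  rintro rfl
  rw [map_zero] at hc
  rw [← hc, zero_sub, neg_mem_iff] at hdet
  exact (Ideal.ne_top_iff_one _).mp hm hdet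

theorem projInt_sub_mem_irrelevant (x : R) :
    projInt 𝒜 0 x - x ∈ (HomogeneousIdeal.irrelevant 𝒜).toIdeal := by
  refine (HomogeneousIdeal.mem_irrelevant_iff 𝒜 _).mpr ?_
  rw [map_sub, sub_eq_zero]
  simp [projInt]

theorem projInt_mem_irrelevant {j : ℤ} (hj : j ≠ 0) (x : R) :
    projInt 𝒜 j x ∈ (HomogeneousIdeal.irrelevant 𝒜).toIdeal := by
  unfold projInt
  split_ifs with h
  · exact HomogeneousIdeal.mem_irrelevant_of_mem 𝒜 (i := j.toNat) (by lia) (by simp)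
  · simp

/-- The graded analogue of `length_le_freeRank_of_isLocalRing`: since `R` is not local, elements and
functionals dual modulo `m` are made homogeneous first, so that the determinant of their pairing is
a constant. -/
theorem length_le_freeRank_of_graded (h0 : 𝒜 0 = LinearMap.range (Algebra.linearMap K R))
    {m : Ideal R} (hm : m = (HomogeneousIdeal.irrelevant 𝒜).toIdeal) [m.IsMaximal] (n : ℕ) :
    Module.length R (R ⧸ diffPower K m (n + 1)) ≤ freeRank R (PrincipalParts K R n) := by
  let J := diffPower K m (n + 1)
  have hproj : ∀ x : R, ∃ c : K, x - algebraMap K R c ∈ m := fun x => by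
    have hx : projInt 𝒜 0 x ∈ 𝒜 0 := by simp [projInt]
    rw [h0] at hx
    obtain ⟨c, hc⟩ := hx
    refine ⟨c, ?_⟩
    rw [Algebra.linearMap_apply] at hc
    rw [hc, hm, ← neg_mem_iff, neg_sub]
    exact projInt_sub_mem_irrelevant x
  have hres : Module.length K (R ⧸ m) = 1 := by
    have hbij : Function.Bijective (Algebra.linearMap K (R ⧸ m)) := by
      refine ⟨(algebraMap K (R ⧸ m)).injective, fun y => ?_⟩
      obtain ⟨x, rfl⟩ := Ideal.Quotient.mk_surjective y
      obtain ⟨c, hc⟩ := hproj x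
      exact ⟨c, (Ideal.Quotient.eq.mpr hc).symm⟩
    rw [← (LinearEquiv.ofBijective _ hbij).length_eq]
    exact Module.length_eq_one K K
  have hlen := length_eq_length_mul m (K := K) (M := R ⧸ J) (n := n) (by
    intro r hr x
    obtain ⟨a, rfl⟩ := Ideal.Quotient.mk_surjective x
    refine Ideal.Quotient.eq_zero_iff_mem.mpr (Ideal.mul_mem_right a _ ?_)
    rw [mem_diffPower_succ_iff]
    exact map_le_nonUnimodular m n (map_univDiff_pow_le m n (Ideal.mem_map_of_mem _ hr)))
  rw [hres, mul_one] at hlen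
  refine ENat.forall_natCast_le_iff_le.mp fun a ha => ?_
  rw [← hlen, Module.length_eq_rank] at ha
  -- homogeneous elements independent modulo the differential power
  have e : (R ⧸ J.restrictScalars K) ≃ₗ[K] R ⧸ J := Submodule.Quotient.restrictScalarsEquiv K J
  obtain ⟨d, f, hfd, hf⟩ := exists_homogeneous_linearIndependent (𝒜 := 𝒜)
    (J.restrictScalars K) (a := a) (by rw [e.rank_eq]; simpa using ha)
  obtain ⟨φ, hφ⟩ := exists_dual_basis_mod (m := m) (fun j => univDiff K R n (f j)) (by
    intro r hr j
    choose c hc using fun j => hproj (r j)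
    have h1 : ∑ j, c j • f j ∈ J := by
      rw [mem_diffPower_succ_iff, map_sum]
      have h2 : ∑ j, (r j - algebraMap K R (c j)) • univDiff K R n (f j) ∈
          nonUnimodular (PrincipalParts K R n) m :=
        sum_mem fun j _ => smul_mem_nonUnimodular (hc j) _
      have h3 := sub_mem hr h2
      rw [← Finset.sum_sub_distrib] at h3
      convert h3 using 2 with j
      rw [map_smul, sub_smul, sub_sub_cancel, algebraMap_smul]
    have h4 : c j = 0 := by
      refine Fintype.linearIndependent_iff.mp hf c ?_ j
      simp only [← map_smul, ← map_sum]
      exact (Submodule.Quotient.mk_eq_zero _).mpr h1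
    simpa [h4] using hc j)
  -- with the component of degree `-d i` of the `i`-th operator, the pairing is still the identity
  -- modulo `m`: off degree zero its entries are in `m`, in degree zero the constant terms are kept
  let δ : Fin a → R →ₗ[K] R := fun i => homogComponent 𝒜
    (((φ i).restrictScalars K).comp (univDiff K R n).toLinearMap) (-d i)
  have hδ : ∀ i, δ i ∈ diffOp K R n := fun i =>
    homogComponent_mem_diffOp (dual_comp_univDiff_mem_diffOp _) _
  choose ψ hψ using fun i => exists_dual_of_mem_diffOp (hδ i)
  have hval : ∀ i j, ψ i (univDiff K R n (f j)) =
      projInt 𝒜 ((d j : ℤ) - d i) (φ i (univDiff K R n (f j))) := fun i j => by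
    rw [hψ]
    exact homogComponent_of_mem _ _ (hfd j)
  refine le_freeRank_of_isUnit_det ψ (fun j => univDiff K R n (f j)) ?_
  refine isUnit_det_of_homogeneous h0 (m := m) (Ideal.IsMaximal.ne_top ‹_›) d
    (fun i j => ⟨_, (hval i j).symm⟩) (det_sub_one_mem m fun i j => ?_)
  rw [Matrix.of_apply, hval]
  by_cases hd : (d j : ℤ) - d i = 0
  · rw [hd, ← sub_add_sub_cancel _ (φ i (univDiff K R n (f j)))]
    exact add_mem (hm ▸ projInt_sub_mem_irrelevant _) (hφ i j)
  · have hij : i ≠ j := fun h => hd (by rw [h, sub_self])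
    rw [if_neg hij, sub_zero, hm]
    exact projInt_mem_irrelevant hd _

end Graded

/-! ### Comparison of normalizations -/

section Limsup

theorem choose_div_le (d n : ℕ) :
    ((n + d).choose n : ℝ≥0∞) / (((n + 1 : ℕ) : ℝ≥0∞) ^ d / (d.factorial : ℝ≥0∞)) ≤
      ENNReal.ofReal ((((n : ℝ) + d) / (n + 1)) ^ d) := by
  have h1 : d.factorial * (n + d).choose n ≤ (n + d) ^ d := by
    rw [Nat.choose_symm_add, ← Nat.ascFactorial_eq_factorial_mul_choose]
    exact Nat.ascFactorial_le_pow_add n d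
  have hf : (d.factorial : ℝ) ≠ 0 := by positivity
  have h2 : ((n + d).choose n : ℝ) / (((n + 1 : ℕ) : ℝ) ^ d / (d.factorial : ℝ)) ≤
      (((n : ℝ) + d) / (n + 1)) ^ d := by
    rw [div_pow, div_div_eq_mul_div]
    push_cast
    gcongr
    rw [mul_comm]
    exact_mod_cast h1
  refine (ENNReal.ofReal_le_ofReal h2).trans' (le_of_eq ?_)
  rw [ENNReal.ofReal_div_of_pos (by positivity), ENNReal.ofReal_div_of_pos (by positivity),
    ENNReal.ofReal_pow (by positivity)]
  simp only [ENNReal.ofReal_natCast]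

/-- `binom(n + d, n)` and `(n + 1) ^ d / d!` are asymptotically equivalent, so either may be used as
normalization. -/
theorem limsup_div_pow_eq_limsup_div_choose (u : ℕ → ℝ≥0∞) (d : ℕ) :
    limsup (fun n : ℕ => u n / (((n + 1 : ℕ) : ℝ≥0∞) ^ d / (d.factorial : ℝ≥0∞))) atTop =
      limsup (fun n : ℕ => u n / ((n + d).choose n : ℝ≥0∞)) atTop := by
  let b : ℕ → ℝ≥0∞ := fun n => ((n + 1 : ℕ) : ℝ≥0∞) ^ d / (d.factorial : ℝ≥0∞)
  let c : ℕ → ℝ≥0∞ := fun n => ((n + d).choose n : ℝ≥0∞)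
  have hc0 : ∀ n, c n ≠ 0 := fun n =>
    Nat.cast_ne_zero.mpr (Nat.choose_pos (Nat.le_add_right n d)).ne'
  have hct : ∀ n, c n ≠ ⊤ := fun n => ENNReal.natCast_ne_top _
  apply le_antisymm
  · by_cases htop : limsup (fun n => u n / c n) atTop = ⊤
    · exact le_top.trans_eq htop.symm
    have hle : limsup (fun n => c n / b n) atTop ≤ 1 := by
      have hlim : Tendsto (fun n : ℕ => ENNReal.ofReal ((((n : ℝ) + d) / (n + 1)) ^ d)) atTop
          (nhds 1) := by
        rw [← ENNReal.ofReal_one, ← one_pow d]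
        refine ENNReal.tendsto_ofReal (Tendsto.pow ?_ d)
        have := tendsto_add_mul_div_add_mul_atTop_nhds (d : ℝ) 1 1 (one_ne_zero (α := ℝ))
        simpa [add_comm] using this
      rw [← hlim.limsup_eq]
      exact limsup_le_limsup (Eventually.of_forall fun n => choose_div_le d n)
    calc limsup (fun n => u n / b n) atTop
        = limsup ((fun n => u n / c n) * fun n => c n / b n) atTop := by
          congr 1
          ext n
          rw [Pi.mul_apply, div_eq_mul_inv (u n) (c n), div_eq_mul_inv (c n), mul_assoc,
            ← mul_assoc _ (c n), ENNReal.inv_mul_cancel (hc0 n) (hct n), one_mul, div_eq_mul_inv]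
      _ ≤ limsup (fun n => u n / c n) atTop * limsup (fun n => c n / b n) atTop :=
          ENNReal.limsup_mul_le' (Or.inr (ne_top_of_le_ne_top ENNReal.one_ne_top hle))
            (Or.inl htop)
      _ ≤ limsup (fun n => u n / c n) atTop * 1 := by gcongr
      _ = _ := mul_one _
  · refine limsup_le_limsup (Eventually.of_forall fun n => ?_)
    refine ENNReal.div_le_div_left (ENNReal.div_le_of_le_mul ?_) _
    have h1 : (n + 1) ^ d ≤ (n + d).choose n * d.factorial := by
      rw [mul_comm, Nat.choose_symm_add, ← Nat.ascFactorial_eq_factorial_mul_choose]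
      exact Nat.pow_succ_le_ascFactorial _ _
    exact_mod_cast h1

/-- The index shift by one between differential powers and principal parts is absorbed by the limit
superior. -/
theorem differentialSignature_eq_complete_of_freeRank_eq {K R : Type*} [Field K] [CommRing R]
    [Algebra K R] (m : Ideal R) (h : ∀ n, freeRank R (PrincipalParts K R n) =
      Module.length R (R ⧸ diffPower K m (n + 1))) :
    differentialSignature K m = completePrincipalPartsSignature K R := by
  unfold differentialSignature completePrincipalPartsSignature
  rw [← limsup_nat_add _ 1]
  simp only [h]
  exact limsup_div_pow_eq_limsup_div_choose _ _

end Limsup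

/-! ### Free ranks and signatures -/

section Main

variable {K R : Type*} [Field K] [CommRing R] [Algebra K R] {m : Ideal R}

theorem freeRank_principalParts_of_isLocalRing [IsLocalRing R]
    (hm : m = IsLocalRing.maximalIdeal R) [Module.Finite K (R ⧸ m)]
    [Algebra.IsSeparable K (R ⧸ m)] (n : ℕ) :
    freeRank R (PrincipalParts K R n) = Module.length R (R ⧸ diffPower K m (n + 1)) := by
  subst hm
  rw [length_quotient_diffPower]
  exact le_antisymm (freeRank_le_length _) length_le_freeRank_of_isLocalRing

theorem freeRank_principalParts_of_isGradedCase (h : IsGradedCase K m) [m.IsMaximal]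
    [Module.Finite K (R ⧸ m)] [Algebra.IsSeparable K (R ⧸ m)] (n : ℕ) :
    freeRank R (PrincipalParts K R n) = Module.length R (R ⧸ diffPower K m (n + 1)) := by
  obtain ⟨-, 𝒜, _, h0, hm⟩ := h
  refine le_antisymm ?_ (length_le_freeRank_of_graded h0 hm n)
  rw [length_quotient_diffPower]
  exact freeRank_le_length _

/-- Here `rank P^n = binom(n + t, n)` with `t = trdeg = dim R`. -/
theorem principalPartsSignature_eq_complete [IsDomain R] [Algebra.EssFiniteType K R]
    (h : IsSeparableExtension K (FractionRing R))
    (hdim : ∀ t : ℕ, Algebra.trdeg K R = t → dim R = t) :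
    principalPartsSignature K R = completePrincipalPartsSignature K R := by
  obtain ⟨t, x, hx, ht⟩ := exists_formallyEtale_of_isSeparableExtension h
  unfold principalPartsSignature completePrincipalPartsSignature
  simp only [genericRank_principalParts_of_formallyEtale K R _ hx, hdim t ht, Fintype.card_fin]
  rfl

theorem differentialSignature_eq_principalPartsSignature [IsDomain R]
    (hm : IsAlgebraWithPseudocoefficientField K m)
    (h : IsSeparableExtension K (FractionRing R)) :
    differentialSignature K m = principalPartsSignature K R := by
  have := hm.isMaximal
  have := hm.finite_residueField
  have := hm.isSeparable_residueField
  obtain hgr | hloc := hm.graded_or_local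
  · have : Algebra.FiniteType K R := hgr.1
    rw [principalPartsSignature_eq_complete h fun t => dim_eq_trdeg_of_finiteType K R]
    exact differentialSignature_eq_complete_of_freeRank_eq m
      (freeRank_principalParts_of_isGradedCase hgr)
  · obtain ⟨_, _, hmax⟩ := hloc
    subst hmax
    rw [principalPartsSignature_eq_complete h fun t => dim_eq_trdeg_of_essFiniteType K R]
    exact differentialSignature_eq_complete_of_freeRank_eq _
      (freeRank_principalParts_of_isLocalRing rfl)

theorem differentialSignature_eq_completePrincipalPartsSignature
    (hm : IsCompleteLocalWithCoefficientField K m) :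
    differentialSignature K m = completePrincipalPartsSignature K R := by
  have := hm.isLocalRing
  have hmax : m.IsMaximal := hm.eq_maximalIdeal ▸ IsLocalRing.maximalIdeal.isMaximal R
  have : Module.Finite K (R ⧸ m) :=
    Module.Finite.of_surjective (Algebra.linearMap K (R ⧸ m)) hm.bijective_residueField.2
  have : Algebra.IsSeparable K (R ⧸ m) := ⟨fun y => by
    obtain ⟨c, rfl⟩ := hm.bijective_residueField.2 y
    exact isSeparable_algebraMap c⟩
  exact differentialSignature_eq_complete_of_freeRank_eq m
    (freeRank_principalParts_of_isLocalRing hm.eq_maximalIdeal)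

end Main

end DiffSig


theorem mainTheorem1 {K R : Type*} [Field K] [CommRing R] [IsDomain R] [Algebra K R]
    (m : Ideal R) :
    (DiffSig.IsAlgebraWithPseudocoefficientField K m →
      DiffSig.IsSeparableExtension K (FractionRing R) →
        DiffSig.differentialSignature K m = DiffSig.principalPartsSignature K R) ∧
    (DiffSig.IsCompleteLocalWithCoefficientField K m →
        DiffSig.differentialSignature K m = DiffSig.completePrincipalPartsSignature K R) :=
  ⟨DiffSig.differentialSignature_eq_principalPartsSignature,
    DiffSig.differentialSignature_eq_completePrincipalPartsSignature⟩
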